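/- Let $(X,\mu_0)$ be a nonatomic probability space. A \emph{tree} is a set $\mathcal T$ of measurable subsets of $X$ of positive $\mu_0$-measure with $X\in\mathcal T$, such that: every $I\in\mathcal T$ has an at most countable set of children $C(I)\subset\mathcal T$ with at least two elements, which pairwise meet in $\mu_0$-null sets and whose union is $I$; $\mathcal T=\bigcup_{n\ge0}\mathcal T_n$, where $\mathcal T_0=\{X\}$ and $\mathcal T_{n+1}=\bigcup_{I\in\mathcal T_n}C(I)$; and $\sup_{I\in\mathcal T_n}\mu_0(I)\to0$ as $n\to\infty$. Write $\langle\varphi\rangle_J=\frac1{\mu_0(J)}\int_J\varphi\,d\mu_0$ and $\mathcal T(J)=\{I\in\mathcal T: I\subset J\}$. For a tree $\mathcal T$ and real numbers $m,M,x_1,x_2,x_3$ let $$\mathbf B^{\mathcal T}(x_1,x_2,x_3;m,M)=\sup\Big\{\int_X|\varphi|^2\,d\mu+\sum_{J\in\mathcal T}|\langle\varphi\rangle_J|^2\alpha_J\Big\},$$ the supremum being taken over all real $\varphi\in L^2(X,\mu_0)$, all families $\alpha=\{\alpha_J\}_{J\in\mathcal T}$ of non-negative numbers, and all non-negative measures $\mu=w\,d\mu_0$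 on $X$ whose density $w$ is measurable with respect to the $\sigma$-algebra generated by $\mathcal T$ (if $\mathcal T$ generates the $\sigma$-algebra of $X$ up to $\mu_0$-null sets, this means just that $\mu$ is absolutely continuous with respect to $\mu_0$), subject to $$\langle\varphi\rangle_X=x_1,\qquad \langle\varphi^2\rangle_X=x_2,\qquad \mu(X)+\sum_{J\in\mathcal T}\alpha_J=x_3,$$ $$m\,\mu_0(J)\le\mu(J)+\sum_{L\in\mathcal T(J)}\alpha_L\le M\mu_0(J)\qquad\text{for all }J\in\mathcal T .$$ \textbf{Theorem.} Let $0\le m\le x_3\le M$ and $x_1^2\le x_2$. (i) If $m<x_3$ and $x_2>0$, then the equation $$\frac{x_1^2}{x_2}=\left[\frac{1-2a(M-x_3)}{1-2a(M-m)}\right]^2\frac{1-4a(M-m)}{1-4a(M-x_3)}$$ has exactly one solution $a$ in $\big[0,\frac1{4(M-m)}\big]$, and with this $a$, for every tree $\mathcal T$, $$\mathbf B^{\mathcal T}(x_1,x_2,x_3;m,M)=\frac{(x_3-m)\,x_2}{[1-2a(M-m)]^2\,[1-4a(M-x_3)]}+m\,x_2 .$$ (ii) If $m<x_3$ and $x_2=0$,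 then $\mathbf B^{\mathcal T}(x_1,x_2,x_3;m,M)=0$ for every tree $\mathcal T$. (iii) If $x_3=m$, then $\mathbf B^{\mathcal T}(x_1,x_2,x_3;m,M)=m\,x_2$ for every tree $\mathcal T$. In particular $\mathbf B^{\mathcal T}(x;m,M)$ depends neither on the tree $\mathcal T$ nor on the space $(X,\mu_0)$. -/

import Mathlib

open Set Filter Topology MeasureTheory
open scoped NNReal ENNReal

noncomputable section

/-- The levels of a tree with children map `C`: level `0` is `{X}`, and level `n + 1` consists of
all children of the elements of level `n`. -/
def treeLevel {X : Type*} (C : Set X → Set (Set X)) : ℕ → Set (Set X)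
  | 0 => {univ}
  | n + 1 => ⋃ I ∈ treeLevel C n, C I

/-- A tree of measurable subsets of the measure space `(X, μ₀)`.
(On a probability space such a tree can exist only if the space is nonatomic.) -/
structure MeasureTree {X : Type*} [MeasurableSpace X] (μ₀ : Measure X) where
  /-- the elements of the tree -/
  nodes : Set (Set X)
  /-- the children `C(I)` of an element `I` (the values outside `nodes` play no role) -/
  children : Set X → Set (Set X)
  measurableSet_of_mem : ∀ I ∈ nodes, MeasurableSet I
  univ_mem : univ ∈ nodes
  measure_pos : ∀ I ∈ nodes, 0 < μ₀ I
  children_subset : ∀ I ∈ nodes, children I ⊆ nodes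
  children_countable : ∀ I ∈ nodes, (children I).Countable
  /-- there are at least two children -/
  children_nontrivial : ∀ I ∈ nodes, (children I).Nontrivial
  /-- distinct children meet in a `μ₀`-null set -/
  children_aedisjoint : ∀ I ∈ nodes, (children I).Pairwise (AEDisjoint μ₀)
  sUnion_children : ∀ I ∈ nodes, ⋃₀ children I = I
  nodes_eq : nodes = ⋃ n, treeLevel children n
  tendsto_sup_measure :
    Tendsto (fun n => ⨆ I ∈ treeLevel children n, μ₀ I) atTop (𝓝 0)

namespace MeasureTree

variable {X : Type*} [MeasurableSpace X] {μ₀ : Measure X}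

/-- The σ-algebra generated by the elements of the tree. -/
abbrev sigmaAlgebra (T : MeasureTree μ₀) : MeasurableSpace X :=
  MeasurableSpace.generateFrom T.nodes

/-- The elements of the tree that are subsets of `J`. -/
def below (T : MeasureTree μ₀) (J : Set X) : Set (Set X) :=
  {I | I ∈ T.nodes ∧ I ⊆ J}

/-- `μ` is a non-negative measure `w dμ₀` whose density `w` is measurable with respect to the
σ-algebra generated by the tree. If the tree generates the whole σ-algebra of `X` up to
`μ₀`-null sets, these are all the σ-finite measures that are absolutely continuous with respect
to `μ₀`, see `isTreeMeasure_of_generates`. -/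
def IsTreeMeasure (T : MeasureTree μ₀) (μ : Measure X) : Prop :=
  ∃ w : X → ℝ≥0∞, Measurable[T.sigmaAlgebra] w ∧ μ = μ₀.withDensity w

/-- The tree generates the σ-algebra of `X` up to `μ₀`-null sets. -/
def Generates (T : MeasureTree μ₀) : Prop :=
  ∀ A : Set X, MeasurableSet A → ∃ B : Set X, MeasurableSet[T.sigmaAlgebra] B ∧ A =ᵐ[μ₀] B

/-- If the tree generates the σ-algebra up to null sets, then the condition `IsTreeMeasure`
restricts an absolutely continuous measure in no way. -/
theorem isTreeMeasure_of_generates [IsFiniteMeasure μ₀] (T : MeasureTree μ₀) (hT : T.Generates)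
    (μ : Measure X) [SigmaFinite μ] (hμ : μ ≪ μ₀) : T.IsTreeMeasure μ := by
  have key : ∀ f : X → ℝ≥0∞, Measurable f →
      ∃ g : X → ℝ≥0∞, Measurable[T.sigmaAlgebra] g ∧ f =ᵐ[μ₀] g := by
    intro f hf
    refine Measurable.ennreal_induction (motive := fun f => ∃ g : X → ℝ≥0∞,
      Measurable[T.sigmaAlgebra] g ∧ f =ᵐ[μ₀] g) ?_ ?_ ?_ hf
    · intro c s hs
      obtain ⟨B, hB, hsB⟩ := hT s hs
      refine ⟨B.indicator fun _ => c, Measurable.indicator measurable_const hB, ?_⟩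
      exact indicator_ae_eq_of_ae_eq_set hsB
    · rintro f g _ _ _ ⟨f₁, hf₁, hff⟩ ⟨g₁, hg₁, hgg⟩
      exact ⟨f₁ + g₁, Measurable.add hf₁ hg₁, hff.add hgg⟩
    · intro f _ _ ih
      choose g hg hfg using ih
      refine ⟨fun x => ⨆ n, g n x, Measurable.iSup hg, ?_⟩
      filter_upwards [ae_all_iff.2 hfg] with x hx
      simp [hx]
  obtain ⟨g, hg, hfg⟩ := key (μ.rnDeriv μ₀) (Measure.measurable_rnDeriv μ μ₀)
  exact ⟨g, hg, by rw [← withDensity_congr_ae hfg, Measure.withDensity_rnDeriv_eq μ μ₀ hμ]⟩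

/-- The competitors `(φ, μ, α)` in the extremal problem with data `(x₁, x₂, x₃; m, M)`.
The averages are taken with respect to `μ₀`; only the values of `α` on the tree matter. -/
structure IsCompetitor (T : MeasureTree μ₀) (m M x₁ x₂ x₃ : ℝ)
    (φ : X → ℝ) (μ : Measure X) (α : Set X → ℝ≥0) : Prop where
  memLp : MemLp φ 2 μ₀
  isTreeMeasure : T.IsTreeMeasure μ
  average_eq : ⨍ t in univ, φ t ∂μ₀ = x₁
  average_sq_eq : ⨍ t in univ, φ t ^ 2 ∂μ₀ = x₂
  mass_eq : μ univ + ∑' J : T.nodes, (α J : ℝ≥0∞) = ENNReal.ofReal x₃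
  lower_bound : ∀ J ∈ T.nodes,
    ENNReal.ofReal m * μ₀ J ≤ μ J + ∑' L : T.below J, (α L : ℝ≥0∞)
  upper_bound : ∀ J ∈ T.nodes,
    μ J + ∑' L : T.below J, (α L : ℝ≥0∞) ≤ ENNReal.ofReal M * μ₀ J

/-- The quantity `∫ |φ|² dμ + ∑_J |⟨φ⟩_J|² α_J`, with values in `[0, ∞]`. -/
def payoff (T : MeasureTree μ₀) (φ : X → ℝ) (μ : Measure X) (α : Set X → ℝ≥0) : ℝ≥0∞ :=
  (∫⁻ t, ENNReal.ofReal (|φ t| ^ 2) ∂μ) +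
    ∑' J : T.nodes, ENNReal.ofReal (|⨍ t in (J : Set X), φ t ∂μ₀| ^ 2) * α J

/-- The tree Bellman function of the Carleson embedding theorem, as a supremum in `[-∞, ∞]`
(so it is `-∞` if there is no competitor). -/
def bellman (T : MeasureTree μ₀) (m M x₁ x₂ x₃ : ℝ) : EReal :=
  sSup {b : EReal | ∃ (φ : X → ℝ) (μ : Measure X) (α : Set X → ℝ≥0),
    T.IsCompetitor m M x₁ x₂ x₃ φ μ α ∧ b = ((T.payoff φ μ α : ℝ≥0∞) : EReal)}

end MeasureTree

/-- `a` is a solution of the cubic equation on the interval `[0, 1 / (4 (M - m))]`. -/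
def IsCubicSolution (m M x₁ x₂ x₃ a : ℝ) : Prop :=
  a ∈ Icc 0 (1 / (4 * (M - m))) ∧
    x₁ ^ 2 / x₂ = ((1 - 2 * a * (M - x₃)) / (1 - 2 * a * (M - m))) ^ 2 *
      ((1 - 4 * a * (M - m)) / (1 - 4 * a * (M - x₃)))

/-- The explicit expression for the Bellman function, in terms of the parameter `a`. -/
def explicitB (m M x₂ x₃ a : ℝ) : ℝ :=
  (x₃ - m) * x₂ / ((1 - 2 * a * (M - m)) ^ 2 * (1 - 4 * a * (M - x₃))) + m * x₂

end

/-! ### Combinatorics of the levels and superadditivity of the mass. -/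

namespace MeasureTree

variable {X : Type*} [MeasurableSpace X] {μ₀ : Measure X} (T : MeasureTree μ₀)

/-! Remove the forced part `m μ₀` and rescale by `M - m`. The normalized excess `Y J` of the mass
then satisfies `0 ≤ Y J ≤ μ₀ J` and is superadditive over children, with surplus `α J / (M - m)`.
Put `y = (x₃ - m) / (M - m)`, `z = 1 - y` and `t = 2 a (M - m)`.

Upper bound. Fix `t ∈ (0, 1)`. Replacing `J` by its children increases `(∫_J φ)² / ((1 - t) μ₀ J + t
Y J)` by at least `t / (M - m)` times the payoff of the atom at `J`; this is Cauchy-Schwarz with a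
gain, `ofReal_sq_div_add_le_tsum`. Summation over the levels, an estimate of the last level by `∫
φ²`, and martingale convergence with Fatou for `∫ φ² dμ` give `IsCompetitor.payoff_le`: the payoff
is at most `(M - m) / t * (x₂ / (1 - t) - x₁² / (1 - t z)) + m x₂`. Stationarity of this bound in
`t` is exactly the cubic equation, whose root is unique because `foliationRatio` is strictly
decreasing; at the root the bound is the claimed value (`normalizedB_eq`).

Lower bound. Near-extremal competitors are self-similar. On an element of average `c`, `φ` is set
equal to `b c` on a small remainder, an atom at the element uses up the mass of that remainder, and
the rest is filled with smaller elements carrying copies of the construction with a corrected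
average. In the limit of small remainders the square average and the payoff per unit of measure are
`c²` times `W = b² / (2b - 1)` and `V = 1 / (2b - 1)` (`hasBlocks_of_lt`). On `X`, such blocks cover
a part of size about `y`, with `φ = b c` elsewhere; `b = 1 - t` reproduces the upper bound. All
elements of a deep level are small, so any proportion of an element can be approximated inside any
tree: this is why the answer does not depend on the tree.

The endpoint `t = 0` forces `φ` to be constant, the endpoint `t = 1/2` means `x₁ = 0`, and `x₃ = m`
forces `α = 0`; these cases are treated separately. -/

/-- The `n`-th level of the tree. -/
abbrev level (n : ℕ) : Set (Set X) := treeLevel T.children n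

theorem level_subset_nodes (n : ℕ) : T.level n ⊆ T.nodes := by
  conv_rhs => rw [T.nodes_eq]
  exact subset_iUnion (fun n => treeLevel T.children n) n

theorem exists_mem_level {J : Set X} (hJ : J ∈ T.nodes) : ∃ n, J ∈ T.level n := by
  rw [T.nodes_eq] at hJ
  exact mem_iUnion.1 hJ

theorem level_countable (n : ℕ) : (T.level n).Countable := by
  induction n with
  | zero => exact countable_singleton _
  | succ n ih => exact ih.biUnion fun I hI => T.children_countable I (T.level_subset_nodes n hI)

theorem subset_of_mem_children {I K : Set X} (hI : I ∈ T.nodes) (hK : K ∈ T.children I) :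
    K ⊆ I := by
  rw [← T.sUnion_children I hI]
  exact subset_sUnion_of_mem hK

theorem nullMeasurableSet_of_mem {J : Set X} (hJ : J ∈ T.nodes) : NullMeasurableSet J μ₀ :=
  (T.measurableSet_of_mem J hJ).nullMeasurableSet

theorem level_pairwise_aedisjoint (n : ℕ) : (T.level n).Pairwise (AEDisjoint μ₀) := by
  induction n with
  | zero => exact pairwise_singleton _ _
  | succ n ih =>
    intro K hK K' hK' hne
    obtain ⟨I, hI, hKI⟩ := mem_iUnion₂.1 hK
    obtain ⟨I', hI', hKI'⟩ := mem_iUnion₂.1 hK'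
    have hIn := T.level_subset_nodes n hI
    have hIn' := T.level_subset_nodes n hI'
    by_cases h : I = I'
    · subst h
      exact T.children_aedisjoint I hIn hKI hKI' hne
    · exact (ih hI hI' h).mono (T.subset_of_mem_children hIn hKI)
        (T.subset_of_mem_children hIn' hKI')

theorem sUnion_level (n : ℕ) : ⋃₀ T.level n = univ := by
  induction n with
  | zero => exact sUnion_singleton _
  | succ n ih =>
    refine eq_univ_of_forall fun x => ?_
    obtain ⟨I, hI, hx⟩ := mem_sUnion.1 (ih.symm ▸ mem_univ x)
    rw [← T.sUnion_children I (T.level_subset_nodes n hI)] at hx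
    obtain ⟨K, hK, hxK⟩ := hx
    exact ⟨K, mem_biUnion hI hK, hxK⟩

theorem exists_ancestor {k n : ℕ} (h : k ≤ n) {L : Set X} (hL : L ∈ T.level n) :
    ∃ I ∈ T.level k, L ⊆ I := by
  induction n, h using Nat.le_induction generalizing L with
  | base => exact ⟨L, hL, Subset.rfl⟩
  | succ n _ ih =>
    obtain ⟨I, hI, hLI⟩ := mem_iUnion₂.1 hL
    obtain ⟨I', hI', hII'⟩ := ih hI
    exact ⟨I', hI', (T.subset_of_mem_children (T.level_subset_nodes n hI) hLI).trans hII'⟩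

theorem subset_or_aedisjoint_of_level {k n : ℕ} (h : k ≤ n) {I J : Set X} (hI : I ∈ T.level k)
    (hJ : J ∈ T.level n) : J ⊆ I ∨ AEDisjoint μ₀ I J := by
  obtain ⟨I', hI', hJI'⟩ := T.exists_ancestor h hJ
  by_cases hII : I = I'
  · exact Or.inl (hII ▸ hJI')
  · exact Or.inr ((T.level_pairwise_aedisjoint k hI hI' hII).mono Subset.rfl hJI')

theorem nested_or_aedisjoint {I J : Set X} (hI : I ∈ T.nodes) (hJ : J ∈ T.nodes) :
    I ⊆ J ∨ J ⊆ I ∨ AEDisjoint μ₀ I J := by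
  obtain ⟨k, hk⟩ := T.exists_mem_level hI
  obtain ⟨n, hn⟩ := T.exists_mem_level hJ
  rcases le_total k n with h | h
  · exact Or.inr (T.subset_or_aedisjoint_of_level h hk hn)
  · exact (T.subset_or_aedisjoint_of_level h hn hk).imp_right fun h => Or.inr h.symm

theorem not_aedisjoint_of_subset {I J L : Set X} (hL : L ∈ T.nodes) (hI : L ⊆ I) (hJ : L ⊆ J) :
    ¬ AEDisjoint μ₀ I J := fun h =>
  (T.measure_pos L hL).ne' (measure_mono_null (subset_inter hI hJ) h)

theorem disjoint_below {I J : Set X} (h : AEDisjoint μ₀ I J) :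
    Disjoint (T.below I) (T.below J) :=
  Set.disjoint_left.2 fun _ hL hL' => T.not_aedisjoint_of_subset hL.1 hL.2 hL'.2 h

theorem level_pairwiseDisjoint_children (n : ℕ) : (T.level n).PairwiseDisjoint T.children := by
  intro I hI I' hI' hne
  refine Set.disjoint_left.2 fun K hK hK' => ?_
  have hIn := T.level_subset_nodes n hI
  have hIn' := T.level_subset_nodes n hI'
  exact T.not_aedisjoint_of_subset (T.children_subset I hIn hK)
    (T.subset_of_mem_children hIn hK) (T.subset_of_mem_children hIn' hK')
    (T.level_pairwise_aedisjoint n hI hI' hne)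

theorem tsum_level_succ (n : ℕ) (f : Set X → ℝ≥0∞) :
    ∑' K : T.level (n + 1), f K = ∑' J : T.level n, ∑' K : T.children J, f K :=
  ENNReal.tsum_biUnion' (T.level_pairwiseDisjoint_children n)

theorem lintegral_eq_tsum_level (n : ℕ) (f : X → ℝ≥0∞) :
    ∫⁻ x, f x ∂μ₀ = ∑' J : T.level n, ∫⁻ x in (J : Set X), f x ∂μ₀ := by
  have := lintegral_biUnion₀ (μ := μ₀) (s := fun J : Set X => J) (T.level_countable n)
    (fun J hJ => T.nullMeasurableSet_of_mem (T.level_subset_nodes n hJ))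
    (T.level_pairwise_aedisjoint n) f
  rw [← this, ← sUnion_eq_biUnion, T.sUnion_level, setLIntegral_univ]

theorem measure_eq_tsum_children {J : Set X} (hJ : J ∈ T.nodes) {μ : Measure X} (hμ : μ ≪ μ₀) :
    μ J = ∑' K : T.children J, μ (K : Set X) := by
  have := measure_biUnion₀ (μ := μ) (f := fun J : Set X => J) (T.children_countable J hJ)
    (fun K hK K' hK' h => hμ (T.children_aedisjoint J hJ hK hK' h))
    (fun K hK => (T.measurableSet_of_mem K (T.children_subset J hJ hK)).nullMeasurableSet)
  rw [← this, ← sUnion_eq_biUnion, T.sUnion_children J hJ]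

theorem hasSum_setIntegral_children {J : Set X} (hJ : J ∈ T.nodes) {f : X → ℝ}
    (hf : IntegrableOn f J μ₀) :
    HasSum (fun K : T.children J => ∫ x in (K : Set X), f x ∂μ₀) (∫ x in J, f x ∂μ₀) := by
  have := (T.children_countable J hJ).to_subtype
  have hU : (⋃ K : T.children J, (K : Set X)) = J := by
    rw [← sUnion_eq_iUnion, T.sUnion_children J hJ]
  have := hasSum_integral_iUnion_ae (μ := μ₀) (f := f) (s := fun K : T.children J => (K : Set X))
    (fun K => T.nullMeasurableSet_of_mem (T.children_subset J hJ K.2))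
    (fun K K' h => T.children_aedisjoint J hJ K.2 K'.2 (Subtype.coe_injective.ne h))
    (by rwa [hU])
  rwa [hU] at this

theorem not_mem_below_of_mem_children {J K : Set X} (hJ : J ∈ T.nodes) (hK : K ∈ T.children J) :
    J ∉ T.below K := by
  rintro ⟨-, hJK⟩
  obtain ⟨K', hK', hne⟩ := (T.children_nontrivial J hJ).exists_ne K
  exact T.not_aedisjoint_of_subset (T.children_subset J hJ hK')
    Subset.rfl ((T.subset_of_mem_children hJ hK').trans hJK)
    (T.children_aedisjoint J hJ hK' hK hne)

theorem add_tsum_below_children_le {J : Set X} (hJ : J ∈ T.nodes) (f : Set X → ℝ≥0∞) :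
    f J + ∑' K : T.children J, ∑' L : T.below K, f L ≤ ∑' L : T.below J, f L := by
  have hd : (T.children J).PairwiseDisjoint T.below := fun K hK K' hK' h =>
    T.disjoint_below (T.children_aedisjoint J hJ hK hK' h)
  have hJU : J ∉ ⋃ K ∈ T.children J, T.below K := by
    simp only [mem_iUnion, not_exists]
    exact fun K hK => T.not_mem_below_of_mem_children hJ hK
  rw [← ENNReal.tsum_biUnion' hd, ← tsum_singleton J f,
    ← ENNReal.summable.tsum_union_disjoint (Set.disjoint_singleton_left.2 hJU) ENNReal.summable]
  refine ENNReal.tsum_mono_subtype f (union_subset (singleton_subset_iff.2 ⟨hJ, Subset.rfl⟩)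
    (iUnion₂_subset fun K hK L hL => ⟨hL.1, hL.2.trans (T.subset_of_mem_children hJ hK)⟩))

/-- The total mass `μ(J) + ∑_{L ⊆ J} α_L` of `J`. -/
noncomputable def mass (μ : Measure X) (α : Set X → ℝ≥0) (J : Set X) : ℝ≥0∞ :=
  μ J + ∑' L : T.below J, (α L : ℝ≥0∞)

theorem below_univ : T.below univ = T.nodes := by
  ext; simp [below]

/-- The source of the whole upper bound: `μ` is additive over children because they overlap in null
sets, and the atom at `J` itself belongs to no child. -/
theorem add_tsum_mass_children_le {μ : Measure X} (hμ : μ ≪ μ₀) (α : Set X → ℝ≥0) {J : Set X}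
    (hJ : J ∈ T.nodes) :
    α J + ∑' K : T.children J, T.mass μ α K ≤ T.mass μ α J := by
  have h := T.add_tsum_below_children_le hJ fun L => (α L : ℝ≥0∞)
  simp only [mass, ENNReal.tsum_add, ← T.measure_eq_tsum_children hJ hμ]
  calc _ = μ J + (α J + ∑' K : T.children J, ∑' L : T.below K, (α L : ℝ≥0∞)) := by ring
    _ ≤ _ := by gcongr

theorem tsum_nodes_le (f : Set X → ℝ≥0∞) :
    ∑' J : T.nodes, f J ≤ ∑' n, ∑' J : T.level n, f J := by
  conv_lhs => rw [T.nodes_eq]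
  exact ENNReal.tsum_iUnion_le_tsum f T.level

end MeasureTree
-- The tree filtration and the recovery of `∫ f dμ` from averages.
namespace MeasureTree

variable {X : Type*} [MeasurableSpace X] {μ₀ : Measure X} (T : MeasureTree μ₀)

/-- The filtration generated by the levels of the tree. -/
def filtration : Filtration ℕ ‹MeasurableSpace X› where
  seq n := MeasurableSpace.generateFrom (⋃ k ≤ n, T.level k)
  mono' _ _ h := MeasurableSpace.generateFrom_mono
    (biUnion_subset_biUnion_left fun _ hk => le_trans hk h)
  le' n := MeasurableSpace.generateFrom_le fun J hJ => by
    obtain ⟨k, -, hk⟩ := mem_iUnion₂.1 hJ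
    exact T.measurableSet_of_mem J (T.level_subset_nodes k hk)

theorem sigmaAlgebra_le_iSup_filtration : T.sigmaAlgebra ≤ ⨆ n, T.filtration n := by
  refine MeasurableSpace.generateFrom_le fun J hJ => ?_
  obtain ⟨n, hn⟩ := T.exists_mem_level hJ
  exact le_iSup (fun n => T.filtration n) n J
    (MeasurableSpace.measurableSet_generateFrom (mem_biUnion (le_refl n) hn))

theorem sigmaAlgebra_le : T.sigmaAlgebra ≤ ‹MeasurableSpace X› :=
  MeasurableSpace.generateFrom_le T.measurableSet_of_mem

theorem measurableSet_filtration {n : ℕ} {J : Set X} (hJ : J ∈ T.level n) :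
    MeasurableSet[T.filtration n] J :=
  MeasurableSpace.measurableSet_generateFrom (mem_biUnion (le_refl n) hJ)

/-- A set of the `n`-th σ-algebra contains almost all or almost nothing of an element of level
`n`. -/
theorem null_inter_or_null_diff {n : ℕ} {J B : Set X} (hJ : J ∈ T.level n)
    (hB : MeasurableSet[T.filtration n] B) : μ₀ (J ∩ B) = 0 ∨ μ₀ (J \ B) = 0 := by
  induction B, hB using MeasurableSpace.generateFrom_induction with
  | hC B hB =>
    obtain ⟨k, hk, hBk⟩ := mem_iUnion₂.1 hB
    rcases T.subset_or_aedisjoint_of_level hk hBk hJ with h | h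
    · exact Or.inr (by rw [Set.sdiff_eq_empty.2 h, measure_empty])
    · exact Or.inl h.symm
  | empty => exact Or.inl (by simp)
  | compl B _ ih =>
    rw [sdiff_compl, ← sdiff_eq]
    exact ih.symm
  | iUnion B _ ih =>
    by_cases h : ∀ i, μ₀ (J ∩ B i) = 0
    · exact Or.inl (by rw [inter_iUnion]; exact measure_iUnion_null h)
    · obtain ⟨i, hi⟩ := not_forall.1 h
      exact Or.inr (measure_mono_null (sdiff_subset_sdiff_right (subset_iUnion B i))
        ((ih i).resolve_left hi))

/-- Elements of a level are atoms of its σ-algebra up to null sets. By the first moment method the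
set where the conditional expectation is at most its average over `J` meets `J` in positive measure,
hence fills almost all of `J`; the same holds for the reverse inequality. -/
theorem condExp_filtration_eq_average [IsProbabilityMeasure μ₀] {g : X → ℝ} (hg : Integrable g μ₀)
    {n : ℕ} {J : Set X} (hJ : J ∈ T.level n) :
    ∀ᵐ x ∂μ₀.restrict J, (μ₀[g | T.filtration n]) x = ⨍ x in J, g x ∂μ₀ := by
  set h := μ₀[g | T.filtration n] with hh
  have hJn := T.level_subset_nodes n hJ
  have hJm := T.measurableSet_of_mem J hJn
  have hJ0 := (T.measure_pos J hJn).ne'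
  have hmeas : Measurable[T.filtration n] h := stronglyMeasurable_condExp.measurable
  have hint : IntegrableOn h J μ₀ := integrable_condExp.integrableOn
  have hav : ⨍ x in J, g x ∂μ₀ = ⨍ x in J, h x ∂μ₀ := by
    rw [setAverage_eq, setAverage_eq, hh,
      setIntegral_condExp (T.filtration.le n) hg (T.measurableSet_filtration hJ)]
  rw [hav]
  have h1 : μ₀ (J \ {x | h x ≤ ⨍ x in J, h x ∂μ₀}) = 0 :=
    (T.null_inter_or_null_diff hJ (measurableSet_le hmeas measurable_const)).resolve_left
      (measure_le_setAverage_pos hJ0 (measure_ne_top _ _) hint).ne'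
  have h2 : μ₀ (J \ {x | ⨍ x in J, h x ∂μ₀ ≤ h x}) = 0 :=
    (T.null_inter_or_null_diff hJ (measurableSet_le measurable_const hmeas)).resolve_left
      (measure_setAverage_le_pos hJ0 (measure_ne_top _ _) hint).ne'
  rw [ae_restrict_iff' hJm, ae_iff]
  refine measure_mono_null (fun x hx => ?_) (measure_union_null h1 h2)
  obtain ⟨hxJ, hne⟩ := Classical.not_imp.1 hx
  rcases lt_or_gt_of_ne hne with hl | hl
  · exact Or.inr ⟨hxJ, not_le.2 hl⟩
  · exact Or.inl ⟨hxJ, not_le.2 hl⟩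

/-- The integral against a tree measure is controlled by the averages of the measure over the
levels of the tree. -/
theorem lintegral_le_of_tsum_level_le [IsProbabilityMeasure μ₀] {μ : Measure X}
    (hμ : T.IsTreeMeasure μ) (hfin : μ univ ≠ ∞) {f : X → ℝ≥0∞} (hf : AEMeasurable f μ₀)
    (hft : ∀ x, f x ≠ ∞) {R : ℝ≥0∞} {n₀ : ℕ}
    (hR : ∀ n ≥ n₀, ∑' J : T.level n, (∫⁻ x in (J : Set X), f x ∂μ₀) * (μ J / μ₀ J) ≤ R) :
    ∫⁻ x, f x ∂μ ≤ R := by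
  obtain ⟨w, hw, rfl⟩ := hμ
  have hwm : Measurable w := hw.mono T.sigmaAlgebra_le le_rfl
  have hwint : ∫⁻ x, w x ∂μ₀ ≠ ∞ := by
    rwa [withDensity_apply _ MeasurableSet.univ, setLIntegral_univ] at hfin
  have hwlt : ∀ᵐ x ∂μ₀, w x < ∞ := ae_lt_top hwm hwint
  have hg : Integrable (fun x => (w x).toReal) μ₀ :=
    integrable_toReal_of_lintegral_ne_top hwm.aemeasurable hwint
  have hgm : StronglyMeasurable[⨆ n, T.filtration n] fun x => (w x).toReal :=
    ((hw.mono T.sigmaAlgebra_le_iSup_filtration le_rfl).ennreal_toReal).stronglyMeasurable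
  set h := fun n => μ₀[fun x => (w x).toReal | T.filtration n] with hh
  -- Lévy's upward theorem; measurability of `w` with respect to the tree is what makes the limit
  -- equal to `w`.
  have hlim : ∀ᵐ x ∂μ₀, Tendsto (fun n => f x * ENNReal.ofReal (h n x)) atTop
      (𝓝 (f x * w x)) := by
    filter_upwards [hg.tendsto_ae_condExp hgm, hwlt] with x hx hwx
    refine ENNReal.Tendsto.const_mul ?_ (Or.inr (hft x))
    have := ENNReal.tendsto_ofReal hx
    rwa [ENNReal.ofReal_toReal hwx.ne] at this
  have hval : ∀ n, ∫⁻ x, f x * ENNReal.ofReal (h n x) ∂μ₀ =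
      ∑' J : T.level n, (∫⁻ x in (J : Set X), f x ∂μ₀) * (μ₀.withDensity w J / μ₀ J) := by
    intro n
    rw [T.lintegral_eq_tsum_level n]
    refine tsum_congr fun J => ?_
    have hJn := T.level_subset_nodes n J.2
    have hJm := T.measurableSet_of_mem J hJn
    have hav : ENNReal.ofReal (⨍ x in (J : Set X), (w x).toReal ∂μ₀) =
        μ₀.withDensity w J / μ₀ J := by
      rw [ofReal_setAverage hg.integrableOn (Eventually.of_forall fun x => ENNReal.toReal_nonneg),
        withDensity_apply _ hJm]
      congr 1
      refine lintegral_congr_ae (ae_restrict_of_ae ?_)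
      filter_upwards [hwlt] with x hx using ENNReal.ofReal_toReal hx.ne
    rw [← hav, ← lintegral_mul_const'' _ hf.restrict]
    refine lintegral_congr_ae ?_
    filter_upwards [T.condExp_filtration_eq_average hg J.2] with x hx
    simp only [hh, hx]
  calc ∫⁻ x, f x ∂μ₀.withDensity w = ∫⁻ x, f x * w x ∂μ₀ := by
        rw [lintegral_withDensity_eq_lintegral_mul₀ hwm.aemeasurable hf]
        exact lintegral_congr fun x => mul_comm _ _
    _ = ∫⁻ x, liminf (fun n => f x * ENNReal.ofReal (h n x)) atTop ∂μ₀ :=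
        lintegral_congr_ae (hlim.mono fun x hx => hx.liminf_eq.symm)
    _ ≤ liminf (fun n => ∫⁻ x, f x * ENNReal.ofReal (h n x) ∂μ₀) atTop :=
        lintegral_liminf_le' fun n => hf.mul
          (stronglyMeasurable_condExp.mono (T.filtration.le n)).measurable.ennreal_ofReal.aemeasurable
    _ ≤ R := by
        refine liminf_le_of_frequently_le' (Eventually.frequently ?_)
        filter_upwards [eventually_ge_atTop n₀] with n hn
        rw [hval]
        exact hR n hn

end MeasureTree
-- The upper bound through a supersolution.
theorem ENNReal.ofReal_le_tsum_ofReal {ι : Type*} {a b : ι → ℝ} {s : ℝ} (ha : HasSum a s)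
    (hb : ∀ i, 0 ≤ b i) (hab : ∀ i, a i ≤ b i) :
    ENNReal.ofReal s ≤ ∑' i, ENNReal.ofReal (b i) := by
  by_cases h : ∑' i, ENNReal.ofReal (b i) = ∞
  · exact h ▸ le_top
  have hs : Summable b := by
    simpa [ENNReal.toReal_ofReal (hb _)] using ENNReal.summable_toReal h
  rw [← ENNReal.ofReal_tsum_of_nonneg hb hs, ← ha.tsum_eq]
  exact ENNReal.ofReal_le_ofReal (ha.summable.tsum_le_tsum hab hs)

/-- A form of the Cauchy-Schwarz inequality with a gain. -/
theorem ofReal_sq_div_add_le_tsum {ι : Type*} [Nonempty ι] {F D : ι → ℝ} {f d s v : ℝ}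
    (hF : HasSum F f) (hD : ∀ i, 0 < D i) (hDs : Summable D) (hs : 0 ≤ s)
    (hd : s + ∑' i, D i ≤ d) (hdv : d ≤ v) :
    ENNReal.ofReal (f ^ 2 / d) + ENNReal.ofReal (s * (f / v) ^ 2) ≤
      ∑' i, ENNReal.ofReal (F i ^ 2 / D i) := by
  have hpos : 0 < ∑' i, D i :=
    hDs.tsum_pos (fun i => (hD i).le) (Classical.arbitrary ι) (hD _)
  set e := d - s with he
  have he0 : 0 < e := by linarith
  have hd0 : 0 < d := by linarith
  have hv0 : 0 < v := by linarith
  -- The tangent inequality `F² / D ≥ 2λF - λ²D` with one common slope `λ = f / e` sums to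
  -- Cauchy-Schwarz with total denominator `e = d - s`. No summability of `F i ^ 2 / D i` is needed.
  have hsum : HasSum (fun i => 2 * (f / e) * F i - (f / e) ^ 2 * D i)
      (2 * (f / e) * f - (f / e) ^ 2 * ∑' i, D i) :=
    (hF.mul_left _).sub (hDs.hasSum.mul_left _)
  have hterm : ∀ i, 2 * (f / e) * F i - (f / e) ^ 2 * D i ≤ F i ^ 2 / D i := by
    intro i
    rw [le_div_iff₀ (hD i)]
    nlinarith [sq_nonneg (F i - f / e * D i)]
  have hmain := ENNReal.ofReal_le_tsum_ofReal hsum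
    (fun i => div_nonneg (sq_nonneg _) (hD i).le) hterm
  rw [← ENNReal.ofReal_add (by positivity) (by positivity)]
  refine (ENNReal.ofReal_le_ofReal ?_).trans hmain
  have h1 : f ^ 2 / e ≤ 2 * (f / e) * f - (f / e) ^ 2 * ∑' i, D i := by
    have : (f / e) ^ 2 * ∑' i, D i ≤ (f / e) ^ 2 * e := by gcongr; linarith
    have h2 : (f / e) ^ 2 * e = f ^ 2 / e := by field_simp
    have h3 : 2 * (f / e) * f = 2 * (f ^ 2 / e) := by ring
    linarith
  refine le_trans ?_ h1
  -- The surplus `s` becomes the gain: both `e` and `d` are at most `v`.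
  have h4 : f ^ 2 / e - f ^ 2 / d = s * (f ^ 2 / (e * d)) := by
    have : s = d - e := by rw [he]; ring
    rw [this]
    field_simp
  have h5 : s * (f / v) ^ 2 ≤ s * (f ^ 2 / (e * d)) := by
    rw [div_pow]
    gcongr
    nlinarith
  linarith

theorem sq_setIntegral_le {X : Type*} [MeasurableSpace X] {μ₀ : Measure X} [IsFiniteMeasure μ₀]
    {φ : X → ℝ} (hφ : MemLp φ 2 μ₀) (J : Set X) :
    (∫ x in J, φ x ∂μ₀) ^ 2 ≤ μ₀.real J * ∫ x in J, φ x ^ 2 ∂μ₀ := by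
  have hi : IntegrableOn φ J μ₀ := (hφ.integrable one_le_two).integrableOn
  have hi2 : IntegrableOn (fun x => φ x ^ 2) J μ₀ := hφ.integrable_sq.integrableOn
  rcases (measureReal_nonneg (μ := μ₀) (s := J)).eq_or_lt with h0 | hpos
  · have : μ₀.restrict J = 0 := by
      rw [Measure.restrict_eq_zero]
      exact (measureReal_eq_zero_iff).1 h0.symm
    simp [this]
  set F := ∫ x in J, φ x ∂μ₀
  set v := μ₀.real J with hv
  have h : 0 ≤ ∫ x in J, (v * φ x - F) ^ 2 ∂μ₀ := integral_nonneg fun x => sq_nonneg _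
  have hexp : ∫ x in J, (v * φ x - F) ^ 2 ∂μ₀ =
      v ^ 2 * (∫ x in J, φ x ^ 2 ∂μ₀) - 2 * v * F * F + v * F ^ 2 := by
    have : ∀ x, (v * φ x - F) ^ 2 = v ^ 2 * φ x ^ 2 - 2 * v * F * φ x + F ^ 2 := fun x => by ring
    simp only [this]
    have h1 : IntegrableOn (fun x => v ^ 2 * φ x ^ 2) J μ₀ := hi2.const_mul _
    have h2 : IntegrableOn (fun x => 2 * v * F * φ x) J μ₀ := hi.const_mul _
    have h12 : IntegrableOn (fun x => v ^ 2 * φ x ^ 2 - 2 * v * F * φ x) J μ₀ := h1.sub h2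
    rw [integral_add h12 (integrable_const _), integral_sub h1 h2, integral_const_mul,
      integral_const_mul, integral_const]
    simp only [measureReal_restrict_apply_univ, smul_eq_mul]
    rfl
  rw [hexp] at h
  nlinarith [h, hpos]

namespace MeasureTree

variable {X : Type*} [MeasurableSpace X] {μ₀ : Measure X} (T : MeasureTree μ₀)

theorem IsTreeMeasure.absolutelyContinuous {T : MeasureTree μ₀} {μ : Measure X}
    (h : T.IsTreeMeasure μ) : μ ≪ μ₀ := by
  obtain ⟨w, -, rfl⟩ := h
  exact withDensity_absolutelyContinuous μ₀ w

theorem setAverage_eq_div (φ : X → ℝ) (J : Set X) :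
    ⨍ x in J, φ x ∂μ₀ = (∫ x in J, φ x ∂μ₀) / μ₀.real J := by
  rw [setAverage_eq, smul_eq_mul, div_eq_inv_mul]

theorem setLIntegral_sq_eq {φ : X → ℝ} (hφ : MemLp φ 2 μ₀) (J : Set X) :
    ∫⁻ x in J, ENNReal.ofReal (|φ x| ^ 2) ∂μ₀ = ENNReal.ofReal (∫ x in J, φ x ^ 2 ∂μ₀) := by
  simp only [sq_abs]
  exact (ofReal_integral_eq_lintegral_ofReal hφ.integrable_sq.integrableOn
    (Eventually.of_forall fun x => sq_nonneg _)).symm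

section UpperBound

variable {m M x₁ x₂ x₃ : ℝ} {φ : X → ℝ} {μ : Measure X} {α : Set X → ℝ≥0}

/-- The excess of the mass of `J` over its lower bound. -/
noncomputable def excess (m M : ℝ) (μ : Measure X) (α : Set X → ℝ≥0) (J : Set X) : ℝ :=
  ((T.mass μ α J).toReal - m * μ₀.real J) / (M - m)

variable {T}

theorem IsCompetitor.mass_ne_top [IsFiniteMeasure μ₀] (h : T.IsCompetitor m M x₁ x₂ x₃ φ μ α)
    {J : Set X} (hJ : J ∈ T.nodes) : T.mass μ α J ≠ ∞ :=
  ne_top_of_le_ne_top (ENNReal.mul_ne_top ENNReal.ofReal_ne_top (measure_ne_top _ _))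
    (h.upper_bound J hJ)

theorem IsCompetitor.le_mass_toReal [IsFiniteMeasure μ₀] (hm : 0 ≤ m)
    (h : T.IsCompetitor m M x₁ x₂ x₃ φ μ α) {J : Set X} (hJ : J ∈ T.nodes) :
    m * μ₀.real J ≤ (T.mass μ α J).toReal := by
  have := ENNReal.toReal_mono (h.mass_ne_top hJ) (h.lower_bound J hJ)
  rwa [ENNReal.toReal_mul, ENNReal.toReal_ofReal hm] at this

theorem IsCompetitor.mass_toReal_le [IsFiniteMeasure μ₀] (hM : 0 ≤ M)
    (h : T.IsCompetitor m M x₁ x₂ x₃ φ μ α) {J : Set X} (hJ : J ∈ T.nodes) :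
    (T.mass μ α J).toReal ≤ M * μ₀.real J := by
  have := ENNReal.toReal_mono
    (ENNReal.mul_ne_top ENNReal.ofReal_ne_top (measure_ne_top _ _)) (h.upper_bound J hJ)
  rwa [ENNReal.toReal_mul, ENNReal.toReal_ofReal hM] at this

theorem IsCompetitor.excess_nonneg [IsFiniteMeasure μ₀] (hm : 0 ≤ m) (hmM : m < M)
    (h : T.IsCompetitor m M x₁ x₂ x₃ φ μ α) {J : Set X} (hJ : J ∈ T.nodes) :
    0 ≤ T.excess m M μ α J :=
  div_nonneg (sub_nonneg.2 (h.le_mass_toReal hm hJ)) (sub_pos.2 hmM).le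

theorem IsCompetitor.excess_le [IsFiniteMeasure μ₀] (hm : 0 ≤ m) (hmM : m < M)
    (h : T.IsCompetitor m M x₁ x₂ x₃ φ μ α) {J : Set X} (hJ : J ∈ T.nodes) :
    T.excess m M μ α J ≤ μ₀.real J := by
  rw [excess, div_le_iff₀ (sub_pos.2 hmM)]
  linarith [h.mass_toReal_le (hm.trans hmM.le) hJ]

theorem measureReal_pos (T : MeasureTree μ₀) [IsFiniteMeasure μ₀] {J : Set X} (hJ : J ∈ T.nodes) :
    0 < μ₀.real J :=
  ENNReal.toReal_pos (T.measure_pos J hJ).ne' (measure_ne_top _ _)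

theorem hasSum_measureReal_children (T : MeasureTree μ₀) [IsFiniteMeasure μ₀] {J : Set X}
    (hJ : J ∈ T.nodes) : HasSum (fun K : T.children J => μ₀.real K) (μ₀.real J) := by
  simpa using T.hasSum_setIntegral_children hJ (f := fun _ => (1 : ℝ)) (by simp)

theorem IsCompetitor.excess_superadditive [IsFiniteMeasure μ₀] (hmM : m < M)
    (h : T.IsCompetitor m M x₁ x₂ x₃ φ μ α) {J : Set X} (hJ : J ∈ T.nodes) :
    Summable (fun K : T.children J => T.excess m M μ α K) ∧
      α J / (M - m) + ∑' K : T.children J, T.excess m M μ α K ≤ T.excess m M μ α J := by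
  have hle := T.add_tsum_mass_children_le h.isTreeMeasure.absolutelyContinuous α hJ
  have hfin : ∑' K : T.children J, T.mass μ α K ≠ ∞ :=
    ne_top_of_le_ne_top (h.mass_ne_top hJ) (le_add_self.trans hle)
  have hs : Summable fun K : T.children J => (T.mass μ α K).toReal := ENNReal.summable_toReal hfin
  have hr := T.hasSum_measureReal_children hJ
  have he := ((hs.hasSum.sub (hr.mul_left m)).div_const (M - m))
  refine ⟨he.summable, ?_⟩
  have h2 : α J + ∑' K : T.children J, (T.mass μ α K).toReal ≤ (T.mass μ α J).toReal := by
    have := ENNReal.toReal_mono (h.mass_ne_top hJ) hle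
    rwa [ENNReal.toReal_add ENNReal.coe_ne_top hfin,
      ENNReal.tsum_toReal_eq fun K => h.mass_ne_top (T.children_subset J hJ K.2)] at this
  have h3 : ∑' K : T.children J, T.excess m M μ α K = _ := he.tsum_eq
  rw [h3, excess, ← add_div]
  have := sub_pos.2 hmM
  gcongr
  linarith

/-- The denominators in the supersolution. -/
noncomputable def weight (T : MeasureTree μ₀) (t m M : ℝ) (μ : Measure X) (α : Set X → ℝ≥0)
    (J : Set X) : ℝ :=
  (1 - t) * μ₀.real J + t * T.excess m M μ α J

theorem IsCompetitor.weight_pos [IsFiniteMeasure μ₀] (hm : 0 ≤ m) (hmM : m < M)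
    (h : T.IsCompetitor m M x₁ x₂ x₃ φ μ α) {t : ℝ} (ht : 0 ≤ t) (ht1 : t < 1) {J : Set X}
    (hJ : J ∈ T.nodes) : 0 < T.weight t m M μ α J :=
  add_pos_of_pos_of_nonneg (mul_pos (sub_pos.2 ht1) (T.measureReal_pos hJ))
    (mul_nonneg ht (h.excess_nonneg hm hmM hJ))

/-- One step down the tree. The weights inherit the surplus `t α J / (M - m)` from the excess, and
the bound `weight ≤ μ₀ J` turns the gain into the squared average over `J`. -/
theorem IsCompetitor.sq_div_weight_le_tsum_children [IsProbabilityMeasure μ₀] (hm : 0 ≤ m)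
    (hmM : m < M) (h : T.IsCompetitor m M x₁ x₂ x₃ φ μ α) {t : ℝ} (ht : 0 ≤ t) (ht1 : t < 1)
    {J : Set X} (hJ : J ∈ T.nodes) :
    ENNReal.ofReal ((∫ x in J, φ x ∂μ₀) ^ 2 / T.weight t m M μ α J) +
        ENNReal.ofReal (t / (M - m)) * (ENNReal.ofReal (|⨍ x in J, φ x ∂μ₀| ^ 2) * α J) ≤
      ∑' K : T.children J,
        ENNReal.ofReal ((∫ x in (K : Set X), φ x ∂μ₀) ^ 2 / T.weight t m M μ α K) := by
  have hMm := sub_pos.2 hmM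
  obtain ⟨hs, hle⟩ := h.excess_superadditive hmM hJ
  have := (T.children_nontrivial J hJ).nonempty.to_subtype
  have hF := T.hasSum_setIntegral_children hJ (h.memLp.integrable one_le_two).integrableOn
  have hW := ((T.hasSum_measureReal_children hJ).mul_left (1 - t)).add (hs.hasSum.mul_left t)
  have hα : (0 : ℝ) ≤ α J := (α J).coe_nonneg
  have key := ofReal_sq_div_add_le_tsum (D := fun K : T.children J => T.weight t m M μ α K)
    (s := t * (α J / (M - m))) (d := T.weight t m M μ α J) (v := μ₀.real J) hF
    (fun K => h.weight_pos hm hmM ht ht1 (T.children_subset J hJ K.2)) hW.summable (by positivity)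
    (by
      have h3 : ∑' K : T.children J, T.weight t m M μ α K = _ := hW.tsum_eq
      rw [h3, weight]
      nlinarith)
    (by
      rw [weight]
      nlinarith [h.excess_le hm hmM hJ])
  refine le_trans (le_of_eq ?_) key
  congr 1
  rw [sq_abs, ← ENNReal.ofReal_coe_nnreal, ← ENNReal.ofReal_mul (by positivity),
    ← ENNReal.ofReal_mul (by positivity), setAverage_eq_div]
  congr 1
  ring

/-- Closes the telescoping at the last level, where the absolutely continuous part of the payoff is
replaced by its level average. -/
theorem IsCompetitor.sq_div_weight_add_le [IsProbabilityMeasure μ₀] (hm : 0 ≤ m)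
    (hmM : m < M) (h : T.IsCompetitor m M x₁ x₂ x₃ φ μ α) {t : ℝ} (ht : 0 ≤ t) (ht1 : t < 1)
    {J : Set X} (hJ : J ∈ T.nodes) :
    ENNReal.ofReal ((∫ x in J, φ x ∂μ₀) ^ 2 / T.weight t m M μ α J) +
        ENNReal.ofReal (t / (M - m)) *
          ((∫⁻ x in J, ENNReal.ofReal (|φ x| ^ 2) ∂μ₀) * (μ J / μ₀ J)) ≤
      ENNReal.ofReal (1 / (1 - t) + t / (M - m) * m) *
        ∫⁻ x in J, ENNReal.ofReal (|φ x| ^ 2) ∂μ₀ := by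
  have hMm := sub_pos.2 hmM
  have ht1' := sub_pos.2 ht1
  have hv := T.measureReal_pos hJ
  have hw := h.weight_pos hm hmM ht ht1 hJ
  have hμJ : μ J ≤ T.mass μ α J := le_self_add
  have hμt : μ J ≠ ∞ := ne_top_of_le_ne_top (h.mass_ne_top hJ) hμJ
  have hμr : μ.real J ≤ (T.mass μ α J).toReal := ENNReal.toReal_mono (h.mass_ne_top hJ) hμJ
  have hμ0 : 0 ≤ μ.real J := measureReal_nonneg
  have hdiv : μ J / μ₀ J = ENNReal.ofReal (μ.real J / μ₀.real J) := by
    rw [ENNReal.ofReal_div_of_pos hv, ofReal_measureReal hμt, ofReal_measureReal]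
  have hq : 0 ≤ ∫ x in J, φ x ^ 2 ∂μ₀ := integral_nonneg fun x => sq_nonneg _
  rw [hdiv, setLIntegral_sq_eq h.memLp, ← ENNReal.ofReal_mul hq,
    ← ENNReal.ofReal_mul (by positivity), ← ENNReal.ofReal_mul (by positivity),
    ← ENNReal.ofReal_add (by positivity) (by positivity)]
  refine ENNReal.ofReal_le_ofReal ?_
  have hF := sq_setIntegral_le h.memLp J
  set q := ∫ x in J, φ x ^ 2 ∂μ₀
  set F := ∫ x in J, φ x ∂μ₀
  set v := μ₀.real J
  have hY0 := h.excess_nonneg hm hmM hJ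
  have hY1 := h.excess_le hm hmM hJ
  have hYm : μ.real J ≤ m * v + (M - m) * T.excess m M μ α J := by
    rw [excess, mul_div_cancel₀ _ hMm.ne']
    linarith
  rw [weight] at hw ⊢
  set Y := T.excess m M μ α J
  have h1 : F ^ 2 / ((1 - t) * v + t * Y) ≤ v * q / ((1 - t) * v + t * Y) := by gcongr
  have h2 : t / (M - m) * (q * (μ.real J / v)) ≤
      t / (M - m) * (q * ((m * v + (M - m) * Y) / v)) := by gcongr
  have h3 : t / (M - m) * (q * ((m * v + (M - m) * Y) / v)) =
      t / (M - m) * m * q + q * (t * Y / v) := by field_simp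
  -- The left side is convex in `Y ∈ [0, v]`: at `Y = 0` it equals `1 / (1 - t)`, at `Y = v` it is
  -- `1 + t ≤ 1 / (1 - t)`.
  have h4 : v / ((1 - t) * v + t * Y) + t * Y / v ≤ 1 / (1 - t) := by
    rw [div_add_div _ _ hw.ne' hv.ne', div_le_div_iff₀ (by positivity) ht1']
    nlinarith [mul_nonneg (mul_nonneg (mul_nonneg ht hY0) (mul_nonneg ht (sub_nonneg.2 hY1)))
      ht1'.le, mul_nonneg (mul_nonneg ht hY0) (mul_nonneg ht hv.le), mul_nonneg ht hY0]
  have h5 := mul_le_mul_of_nonneg_left h4 hq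
  have h6 : q * (v / ((1 - t) * v + t * Y) + t * Y / v) =
    v * q / ((1 - t) * v + t * Y) + q * (t * Y / v) := by ring
  rw [add_mul, mul_comm (1 / (1 - t)) q]
  linarith

/-- The payoff of the elements of the first `n` levels. -/
noncomputable def partialPayoff (T : MeasureTree μ₀) (φ : X → ℝ) (α : Set X → ℝ≥0) (n : ℕ) :
    ℝ≥0∞ :=
  ∑ k ∈ Finset.range n,
    ∑' J : T.level k, ENNReal.ofReal (|⨍ t in (J : Set X), φ t ∂μ₀| ^ 2) * α J

/-- Freezing the partial payoff at `n` and applying the Fatou bound along later levels gives `∫ φ²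
dμ ≤ R - partialPayoff n` for every `n`; only then does `n` tend to infinity. This handles both
parts of the payoff with the single constant `R`. -/
theorem payoff_le_of_partialPayoff_le [IsProbabilityMeasure μ₀] (hμ : T.IsTreeMeasure μ)
    (hfin : μ univ ≠ ∞) (hφ : AEMeasurable φ μ₀) {R : ℝ≥0∞}
    (hR : ∀ n, T.partialPayoff φ α n + ∑' J : T.level n,
      (∫⁻ x in (J : Set X), ENNReal.ofReal (|φ x| ^ 2) ∂μ₀) * (μ J / μ₀ J) ≤ R) :
    T.payoff φ μ α ≤ R := by
  by_cases hRt : R = ∞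
  · exact hRt ▸ le_top
  have hmono : Monotone (T.partialPayoff φ α) := fun a b hab =>
    Finset.sum_le_sum_of_subset (Finset.range_mono hab)
  have hS : ∀ n, T.partialPayoff φ α n ≤ R := fun n => le_self_add.trans (hR n)
  have hI : ∀ n, ∫⁻ x, ENNReal.ofReal (|φ x| ^ 2) ∂μ ≤ R - T.partialPayoff φ α n := fun n =>
    T.lintegral_le_of_tsum_level_le hμ hfin ((hφ.abs.pow_const 2).ennreal_ofReal)
      (fun x => ENNReal.ofReal_ne_top) (n₀ := n) fun k hk =>
        ENNReal.le_sub_of_add_le_left (ne_top_of_le_ne_top hRt (hS n))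
          ((add_le_add_left (hmono hk) _).trans (hR k))
  have hIR : ∫⁻ x, ENNReal.ofReal (|φ x| ^ 2) ∂μ ≤ R := (hI 0).trans tsub_le_self
  have hsum : ∑' n, ∑' J : T.level n, ENNReal.ofReal (|⨍ t in (J : Set X), φ t ∂μ₀| ^ 2) * α J ≤
      R - ∫⁻ x, ENNReal.ofReal (|φ x| ^ 2) ∂μ := by
    refine ENNReal.tsum_le_of_sum_range_le fun n => ?_
    refine ENNReal.le_sub_of_add_le_left (ne_top_of_le_ne_top hRt hIR) ?_
    exact add_le_of_le_tsub_right_of_le (hS n) (hI n)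
  calc T.payoff φ μ α ≤ (∫⁻ x, ENNReal.ofReal (|φ x| ^ 2) ∂μ) +
        (R - ∫⁻ x, ENNReal.ofReal (|φ x| ^ 2) ∂μ) := by
        unfold payoff
        gcongr
        exact (T.tsum_nodes_le fun J => ENNReal.ofReal (|⨍ t in J, φ t ∂μ₀| ^ 2) * α J).trans hsum
    _ = R := add_tsub_cancel_of_le hIR

theorem IsCompetitor.average_eq_integral [IsProbabilityMeasure μ₀]
    (h : T.IsCompetitor m M x₁ x₂ x₃ φ μ α) : ∫ x, φ x ∂μ₀ = x₁ := by
  have := h.average_eq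
  rwa [setAverage_eq_div, probReal_univ, div_one, setIntegral_univ] at this

theorem IsCompetitor.integral_sq_eq [IsProbabilityMeasure μ₀]
    (h : T.IsCompetitor m M x₁ x₂ x₃ φ μ α) : ∫ x, φ x ^ 2 ∂μ₀ = x₂ := by
  have := h.average_sq_eq
  rwa [setAverage_eq_div, probReal_univ, div_one, setIntegral_univ] at this

theorem IsCompetitor.mass_univ (h : T.IsCompetitor m M x₁ x₂ x₃ φ μ α) :
    T.mass μ α univ = ENNReal.ofReal x₃ := by
  rw [mass, T.below_univ, h.mass_eq]

theorem IsCompetitor.measure_univ_ne_top (h : T.IsCompetitor m M x₁ x₂ x₃ φ μ α) :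
    μ univ ≠ ∞ :=
  ne_top_of_le_ne_top ENNReal.ofReal_ne_top (le_self_add.trans_eq h.mass_eq)

theorem lintegral_sq_eq [IsProbabilityMeasure μ₀] (h : T.IsCompetitor m M x₁ x₂ x₃ φ μ α) :
    ∫⁻ x, ENNReal.ofReal (|φ x| ^ 2) ∂μ₀ = ENNReal.ofReal x₂ := by
  rw [← setLIntegral_univ, setLIntegral_sq_eq h.memLp, setIntegral_univ, h.integral_sq_eq]

theorem IsCompetitor.payoff_le [IsProbabilityMeasure μ₀] (hm : 0 ≤ m) (hmM : m < M)
    (hx₃ : 0 ≤ x₃) (h : T.IsCompetitor m M x₁ x₂ x₃ φ μ α) {t : ℝ} (ht : 0 < t) (ht1 : t < 1) :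
    T.payoff φ μ α ≤ ENNReal.ofReal ((M - m) / t *
      (x₂ / (1 - t) - x₁ ^ 2 / ((1 - t) + t * ((x₃ - m) / (M - m)))) + m * x₂) := by
  have hMm := sub_pos.2 hmM
  have ht1' := sub_pos.2 ht1
  set G : Set X → ℝ≥0∞ := fun J =>
    ENNReal.ofReal ((∫ x in J, φ x ∂μ₀) ^ 2 / T.weight t m M μ α J) with hG
  set τ := ENNReal.ofReal (t / (M - m)) with hτ
  -- Telescoping of the one-step inequality over the first `n` levels.
  have hind : ∀ n, G univ + τ * T.partialPayoff φ α n ≤ ∑' J : T.level n, G J := by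
    intro n
    induction n with
    | zero =>
      have : ∑' J : T.level 0, G J = G univ := tsum_singleton univ G
      simp [partialPayoff, this]
    | succ n ih =>
      rw [T.tsum_level_succ, partialPayoff, Finset.sum_range_succ, mul_add, ← add_assoc]
      refine (add_le_add_left ih _).trans ?_
      rw [← ENNReal.tsum_mul_left, ← ENNReal.tsum_add]
      exact ENNReal.tsum_le_tsum fun J =>
        h.sq_div_weight_le_tsum_children hm hmM ht.le ht1 (T.level_subset_nodes n J.2)
  have hx₂ : 0 ≤ x₂ := h.integral_sq_eq ▸ integral_nonneg fun x => sq_nonneg _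
  have hw := h.weight_pos hm hmM ht.le ht1 T.univ_mem
  have hGu : G univ = ENNReal.ofReal (x₁ ^ 2 / ((1 - t) + t * ((x₃ - m) / (M - m)))) := by
    simp only [hG, weight, excess, h.mass_univ, ENNReal.toReal_ofReal hx₃, setIntegral_univ,
      h.average_eq_integral, probReal_univ, mul_one]
  have hwpos : 0 < (1 - t) + t * ((x₃ - m) / (M - m)) := by
    simpa only [weight, excess, h.mass_univ, ENNReal.toReal_ofReal hx₃, probReal_univ,
      mul_one] using hw
  refine payoff_le_of_partialPayoff_le h.isTreeMeasure h.measure_univ_ne_top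
    h.memLp.aestronglyMeasurable.aemeasurable fun n => ?_
  set P := T.partialPayoff φ α n + ∑' J : T.level n,
      (∫⁻ x in (J : Set X), ENNReal.ofReal (|φ x| ^ 2) ∂μ₀) * (μ J / μ₀ J) with hP
  have h1 : G univ + τ * P ≤ ENNReal.ofReal ((1 / (1 - t) + t / (M - m) * m) * x₂) := by
    rw [hP, mul_add, ← add_assoc]
    refine (add_le_add_left (hind n) _).trans ?_
    rw [ENNReal.ofReal_mul (by positivity), ← lintegral_sq_eq h, T.lintegral_eq_tsum_level n,
      ← ENNReal.tsum_mul_left, ← ENNReal.tsum_mul_left, ← ENNReal.tsum_add]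
    exact ENNReal.tsum_le_tsum fun J =>
      h.sq_div_weight_add_le hm hmM ht.le ht1 (T.level_subset_nodes n J.2)
  have h2 : τ * P ≤ ENNReal.ofReal ((1 / (1 - t) + t / (M - m) * m) * x₂ -
      x₁ ^ 2 / ((1 - t) + t * ((x₃ - m) / (M - m)))) := by
    rw [ENNReal.ofReal_sub _ (by positivity), ← hGu]
    exact ENNReal.le_sub_of_add_le_left (hGu ▸ ENNReal.ofReal_ne_top) h1
  have hτ0 : 0 < t / (M - m) := by positivity
  have h3 : P = ENNReal.ofReal ((M - m) / t) * (τ * P) := by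
    rw [← mul_assoc, hτ, ← ENNReal.ofReal_mul (by positivity),
      show (M - m) / t * (t / (M - m)) = 1 by field_simp, ENNReal.ofReal_one, one_mul]
  rw [h3]
  refine (mul_le_mul_right h2 _).trans (le_of_eq ?_)
  rw [← ENNReal.ofReal_mul (by positivity)]
  congr 1
  field_simp
  ring

end UpperBound

end MeasureTree
-- Rigid cases: minimal mass, and constant `φ`.
namespace MeasureTree

variable {X : Type*} [MeasurableSpace X] {μ₀ : Measure X} {T : MeasureTree μ₀}
  {m M x₁ x₂ x₃ : ℝ} {φ : X → ℝ} {μ : Measure X} {α : Set X → ℝ≥0}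

theorem tsum_level_mass_le (hμ : μ ≪ μ₀) (n : ℕ) :
    ∑' J : T.level n, T.mass μ α J ≤ T.mass μ α univ := by
  induction n with
  | zero => exact (tsum_singleton univ (T.mass μ α)).le
  | succ n ih =>
    rw [T.tsum_level_succ]
    exact (ENNReal.tsum_le_tsum fun J => le_add_self.trans
      (T.add_tsum_mass_children_le hμ α (T.level_subset_nodes n J.2))).trans ih

theorem tsum_level_measure (T : MeasureTree μ₀) (n : ℕ) : ∑' J : T.level n, μ₀ J = μ₀ univ := by
  simpa using (T.lintegral_eq_tsum_level n fun _ => 1).symm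

/-- On each level the lower bounds already add up to the whole available mass `m`, so none of them
can be strict. -/
theorem IsCompetitor.mass_eq_of_eq [IsProbabilityMeasure μ₀]
    (h : T.IsCompetitor m M x₁ x₂ m φ μ α) {J : Set X} (hJ : J ∈ T.nodes) :
    T.mass μ α J = ENNReal.ofReal m * μ₀ J := by
  obtain ⟨n, hn⟩ := T.exists_mem_level hJ
  refine le_antisymm (le_of_not_gt fun hlt => ?_) (h.lower_bound J hJ)
  have h1 : ∑' J : T.level n, ENNReal.ofReal m * μ₀ J = ENNReal.ofReal m := by
    rw [ENNReal.tsum_mul_left, T.tsum_level_measure, measure_univ, mul_one]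
  have h2 := ENNReal.tsum_lt_tsum (f := fun J : T.level n => ENNReal.ofReal m * μ₀ J)
    (g := fun J : T.level n => T.mass μ α J) (by rw [h1]; exact ENNReal.ofReal_ne_top)
    (fun J => h.lower_bound J (T.level_subset_nodes n J.2)) (i := ⟨J, hn⟩) hlt
  rw [h1] at h2
  have h3 := tsum_level_mass_le (T := T) (α := α) h.isTreeMeasure.absolutelyContinuous n
  rw [h.mass_univ] at h3
  exact absurd h3 (not_le.2 h2)

theorem IsCompetitor.alpha_eq_zero_of_eq [IsProbabilityMeasure μ₀]
    (h : T.IsCompetitor m M x₁ x₂ m φ μ α) {J : Set X} (hJ : J ∈ T.nodes) : α J = 0 := by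
  have h1 := T.add_tsum_mass_children_le h.isTreeMeasure.absolutelyContinuous α hJ
  have h2 : ∑' K : T.children J, T.mass μ α K = T.mass μ α J := by
    rw [h.mass_eq_of_eq hJ, T.measure_eq_tsum_children hJ Measure.AbsolutelyContinuous.rfl,
      ← ENNReal.tsum_mul_left]
    exact tsum_congr fun K => h.mass_eq_of_eq (T.children_subset J hJ K.2)
  rw [h2] at h1
  have h3 : (α J : ℝ≥0∞) + T.mass μ α J ≤ 0 + T.mass μ α J := by rwa [zero_add]
  simpa using (ENNReal.add_le_add_iff_right (h.mass_ne_top hJ)).1 h3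

theorem IsCompetitor.payoff_le_of_eq [IsProbabilityMeasure μ₀] (hm : 0 ≤ m)
    (h : T.IsCompetitor m M x₁ x₂ m φ μ α) : T.payoff φ μ α ≤ ENNReal.ofReal (m * x₂) := by
  refine payoff_le_of_partialPayoff_le h.isTreeMeasure h.measure_univ_ne_top
    h.memLp.aestronglyMeasurable.aemeasurable fun n => ?_
  have h0 : T.partialPayoff φ α n = 0 := by
    refine Finset.sum_eq_zero fun k _ => ENNReal.tsum_eq_zero.2 fun J => ?_
    rw [h.alpha_eq_zero_of_eq (T.level_subset_nodes k J.2)]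
    simp
  rw [h0, zero_add, ENNReal.ofReal_mul hm, ← lintegral_sq_eq h, T.lintegral_eq_tsum_level n,
    ← ENNReal.tsum_mul_left]
  refine ENNReal.tsum_le_tsum fun J => ?_
  have hJ := T.level_subset_nodes n J.2
  rw [mul_comm]
  gcongr
  refine ENNReal.div_le_of_le_mul ?_
  rw [← h.mass_eq_of_eq hJ]
  exact le_self_add

theorem IsCompetitor.ae_eq_of_sq_eq [IsProbabilityMeasure μ₀]
    (h : T.IsCompetitor m M x₁ x₂ x₃ φ μ α) (hx : x₁ ^ 2 = x₂) : ∀ᵐ x ∂μ₀, φ x = x₁ := by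
  have hi : Integrable φ μ₀ := h.memLp.integrable one_le_two
  have hi2 : Integrable (fun x => φ x ^ 2) μ₀ := h.memLp.integrable_sq
  have he : ∀ x, (φ x - x₁) ^ 2 = φ x ^ 2 - 2 * x₁ * φ x + x₁ ^ 2 := fun x => by ring
  have h1 : Integrable (fun x => 2 * x₁ * φ x) μ₀ := hi.const_mul _
  have h12 : Integrable (fun x => φ x ^ 2 - 2 * x₁ * φ x) μ₀ := hi2.sub h1
  have h3 : Integrable (fun x => (φ x - x₁) ^ 2) μ₀ := by
    simp only [he]
    exact h12.add (integrable_const _)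
  have h0 : ∫ x, (φ x - x₁) ^ 2 ∂μ₀ = 0 := by
    simp only [he]
    rw [integral_add h12 (integrable_const _), integral_sub hi2 h1, integral_const_mul,
      integral_const, h.integral_sq_eq, h.average_eq_integral, ← hx]
    simp
    ring
  filter_upwards [(integral_eq_zero_iff_of_nonneg (fun x => sq_nonneg _) h3).1 h0] with x hxx
  exact sub_eq_zero.1 (pow_eq_zero_iff two_ne_zero |>.1 hxx)

theorem IsCompetitor.payoff_eq_of_sq_eq [IsProbabilityMeasure μ₀]
    (h : T.IsCompetitor m M x₁ x₂ x₃ φ μ α) (hx : x₁ ^ 2 = x₂) :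
    T.payoff φ μ α = ENNReal.ofReal (x₃ * x₂) := by
  have hae := h.ae_eq_of_sq_eq hx
  have h1 : ∫⁻ x, ENNReal.ofReal (|φ x| ^ 2) ∂μ = ENNReal.ofReal x₂ * μ univ := by
    rw [← lintegral_const]
    refine lintegral_congr_ae (h.isTreeMeasure.absolutelyContinuous.ae_le ?_)
    filter_upwards [hae] with x hxx
    rw [hxx, sq_abs, hx]
  have h2 : ∀ J : T.nodes, ENNReal.ofReal (|⨍ t in (J : Set X), φ t ∂μ₀| ^ 2) =
      ENNReal.ofReal x₂ := by
    intro J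
    have hv := T.measureReal_pos J.2
    rw [setAverage_eq_div, integral_congr_ae (ae_restrict_of_ae hae), integral_const,
      measureReal_restrict_apply_univ, smul_eq_mul, mul_div_cancel_left₀ _ hv.ne', sq_abs, hx]
  have hx2 : 0 ≤ x₂ := hx ▸ sq_nonneg _
  simp only [payoff, h1, h2]
  rw [ENNReal.tsum_mul_left, ← mul_add, h.mass_eq, ← ENNReal.ofReal_mul hx2, mul_comm]

end MeasureTree

/-! ### One-variable analysis of the cubic equation. -/

/-- The right-hand side of the equation for the foliation parameter, in normalized form. -/
noncomputable def foliationRatio (z t : ℝ) : ℝ :=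
  ((1 - t * z) / (1 - t)) ^ 2 * ((1 - 2 * t) / (1 - 2 * t * z))

theorem foliationRatio_strictAntiOn {z : ℝ} (hz : 0 ≤ z) (hz1 : z < 1) :
    StrictAntiOn (foliationRatio z) (Icc 0 (1 / 2)) := by
  -- With `p = t / (1 - t)` and `k = z (1 - t) / (1 - t z)` the ratio is `(1 - p²) / (1 - k² p²)`.
  -- As `t` grows, `p` increases in `[0, 1]` and `k < 1` does not increase, and both changes push
  -- the ratio down.
  have bounds : ∀ t ∈ Icc (0 : ℝ) (1 / 2), 0 < 1 - t ∧ 0 < 1 - t * z ∧ 0 < 1 - 2 * t * z ∧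
      foliationRatio z t =
        (1 - (t / (1 - t)) ^ 2) / (1 - (z * (1 - t) / (1 - t * z)) ^ 2 * (t / (1 - t)) ^ 2) := by
    intro t ht
    have h1 : 0 < 1 - t := by linarith [ht.2]
    have h2 : 0 < 1 - t * z := by nlinarith [ht.1, ht.2]
    have h3 : 0 < 1 - 2 * t * z := by nlinarith [ht.1, ht.2]
    refine ⟨h1, h2, h3, ?_⟩
    have e1 : 1 - (t / (1 - t)) ^ 2 = (1 - 2 * t) / (1 - t) ^ 2 := by
      field_simp
      ring
    have e2 : 1 - (z * (1 - t) / (1 - t * z)) ^ 2 * (t / (1 - t)) ^ 2 =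
        (1 - 2 * t * z) / (1 - t * z) ^ 2 := by
      have hw : 1 - 2 * t * z = (1 - t * z) ^ 2 - (t * z) ^ 2 := by ring
      rw [hw]
      generalize 1 - t * z = w at h2
      field_simp
    rw [e1, e2, foliationRatio]
    field_simp
  intro s hs t ht hst
  obtain ⟨hs1, hs2, -, es⟩ := bounds s hs
  obtain ⟨ht1, ht2, -, et⟩ := bounds t ht
  rw [es, et]
  have hp0 : 0 ≤ s / (1 - s) := div_nonneg hs.1 hs1.le
  have hA : (s / (1 - s)) ^ 2 < (t / (1 - t)) ^ 2 := by
    gcongr ?_ ^ 2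
    rw [div_lt_div_iff₀ hs1 ht1]
    nlinarith
  have hB : (t / (1 - t)) ^ 2 ≤ 1 := by
    refine pow_le_one₀ (div_nonneg ht.1 ht1.le) ?_
    rw [div_le_one ht1]
    linarith [ht.2]
  have hK0 : 0 ≤ z * (1 - t) / (1 - t * z) := by positivity
  have hK : (z * (1 - t) / (1 - t * z)) ^ 2 ≤ (z * (1 - s) / (1 - s * z)) ^ 2 := by
    gcongr ?_ ^ 2
    rw [div_le_div_iff₀ ht2 hs2]
    nlinarith [mul_nonneg hz (mul_nonneg (sub_nonneg.2 hst.le) (sub_nonneg.2 hz1.le))]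
  have hK1 : (z * (1 - s) / (1 - s * z)) ^ 2 < 1 := by
    refine pow_lt_one₀ (by positivity) ?_ two_ne_zero
    rw [div_lt_one hs2]
    nlinarith
  have hA0 := sq_nonneg (s / (1 - s))
  have hK0' := sq_nonneg (z * (1 - t) / (1 - t * z))
  set A := (s / (1 - s)) ^ 2
  set B := (t / (1 - t)) ^ 2
  set K := (z * (1 - s) / (1 - s * z)) ^ 2
  set K' := (z * (1 - t) / (1 - t * z)) ^ 2
  have d1 : 0 < 1 - K' * B := by nlinarith
  have d2 : 0 < 1 - K * A := by nlinarith
  rw [div_lt_div_iff₀ d1 d2]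
  nlinarith [mul_pos (sub_pos.2 hA) (sub_pos.2 hK1),
    mul_nonneg (mul_nonneg (hA0.trans hA.le) (sub_nonneg.2 hK)) (sub_nonneg.2 (hA.le.trans hB))]

theorem foliationRatio_continuousOn {z : ℝ} (hz : 0 ≤ z) (hz1 : z < 1) :
    ContinuousOn (foliationRatio z) (Icc 0 (1 / 2)) := by
  unfold foliationRatio
  refine ContinuousOn.mul (ContinuousOn.pow (ContinuousOn.div (by fun_prop) (by fun_prop) ?_) 2)
    (ContinuousOn.div (by fun_prop) (by fun_prop) ?_)
  · intro t ht
    have := ht.2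
    exact (by linarith : 0 < 1 - t).ne'
  · intro t ht
    exact (by nlinarith [ht.1, ht.2] : 0 < 1 - 2 * t * z).ne'

theorem exists_foliationRatio_eq {z r : ℝ} (hz : 0 ≤ z) (hz1 : z < 1) (hr : r ∈ Icc (0 : ℝ) 1) :
    ∃ t ∈ Icc (0 : ℝ) (1 / 2), foliationRatio z t = r := by
  have h := intermediate_value_Icc' (by norm_num : (0 : ℝ) ≤ 1 / 2)
    (foliationRatio_continuousOn hz hz1)
  have h0 : foliationRatio z 0 = 1 := by simp [foliationRatio]
  have h1 : foliationRatio z (1 / 2) = 0 := by simp [foliationRatio]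
  rw [h0, h1] at h
  exact h hr

theorem isCubicSolution_iff {m M x₁ x₂ x₃ : ℝ} (hmM : m < M) (a : ℝ) :
    IsCubicSolution m M x₁ x₂ x₃ a ↔ 2 * a * (M - m) ∈ Icc (0 : ℝ) (1 / 2) ∧
      x₁ ^ 2 / x₂ = foliationRatio ((M - x₃) / (M - m)) (2 * a * (M - m)) := by
  have hMm := sub_pos.2 hmM
  have e1 : 2 * a * (M - m) * ((M - x₃) / (M - m)) = 2 * a * (M - x₃) := by field_simp
  have e2 : 2 * (2 * a * (M - m)) * ((M - x₃) / (M - m)) = 4 * a * (M - x₃) := by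
    field_simp
    ring
  have e3 : 2 * (2 * a * (M - m)) = 4 * a * (M - m) := by ring
  rw [IsCubicSolution, foliationRatio, e1, e2, e3]
  refine and_congr ?_ Iff.rfl
  rw [mem_Icc, mem_Icc, le_div_iff₀ (by positivity)]
  constructor
  · rintro ⟨h1, h2⟩
    exact ⟨by positivity, by linarith⟩
  · rintro ⟨h1, h2⟩
    exact ⟨by by_contra! h; nlinarith [mul_neg_of_neg_of_pos h hMm], by linarith⟩

/-- The value of the Bellman function for `m = 0`, `M = 1`, in terms of `t = 2 a`. -/
noncomputable def normalizedB (x₂ y t : ℝ) : ℝ :=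
  y * x₂ / ((1 - t) ^ 2 * (1 - 2 * t * (1 - y)))

theorem explicitB_eq {m M x₂ x₃ a : ℝ} (hmM : m < M) :
    explicitB m M x₂ x₃ a =
      (M - m) * normalizedB x₂ ((x₃ - m) / (M - m)) (2 * a * (M - m)) + m * x₂ := by
  have hMm := sub_pos.2 hmM
  have e1 : 1 - (x₃ - m) / (M - m) = (M - x₃) / (M - m) := by
    field_simp
    ring
  have e2 : 2 * (2 * a * (M - m)) * ((M - x₃) / (M - m)) = 4 * a * (M - x₃) := by
    field_simp
    ring
  rw [explicitB, normalizedB, e1, e2, ← mul_div_assoc]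
  congr 2
  field_simp

/-- Evaluates the upper bound at its stationary point `t`: the equation eliminates `x₁`. -/
theorem normalizedB_eq {x₁ x₂ y t : ℝ} (hx₂ : 0 < x₂) (hy : 0 < y) (ht : 0 < t)
    (ht2 : t ≤ 1 / 2) (h : x₁ ^ 2 / x₂ = foliationRatio (1 - y) t) :
    1 / t * (x₂ / (1 - t) - x₁ ^ 2 / ((1 - t) + t * y)) = normalizedB x₂ y t := by
  have h1 : 0 < 1 - t := by linarith
  have h2 : 0 < 1 - 2 * t * (1 - y) := by nlinarith
  have h3 : 0 < (1 - t) + t * y := by positivity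
  have h4 : 1 - t * (1 - y) = (1 - t) + t * y := by ring
  rw [div_eq_iff hx₂.ne', foliationRatio, h4] at h
  have h5 : (1 - t) * (1 - 2 * t * (1 - y)) - ((1 - t) + t * y) * (1 - 2 * t) = t * y := by ring
  rw [h, normalizedB]
  generalize 1 - 2 * t * (1 - y) = d at *
  generalize (1 - t) + t * y = e at *
  field_simp
  linear_combination h5
-- Prescribed proportions of an element, and basic blocks.
theorem Finset.exists_sum_mem_Ioc {ι : Type*} [DecidableEq ι] {g : ι → ℝ} {a b : ℝ}
    (hg : ∀ i, g i ≤ b - a) (ha : 0 ≤ a) (F : Finset ι) (hF : a < ∑ i ∈ F, g i) :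
    ∃ F' : Finset ι, a < ∑ i ∈ F', g i ∧ ∑ i ∈ F', g i ≤ b := by
  induction F using Finset.induction_on with
  | empty => simp at hF; linarith
  | insert i F hi ih =>
    by_cases h : a < ∑ i ∈ F, g i
    · exact ih h
    · refine ⟨insert i F, hF, ?_⟩
      rw [Finset.sum_insert hi]
      linarith [hg i]

namespace MeasureTree

variable {X : Type*} [MeasurableSpace X] {μ₀ : Measure X} (T : MeasureTree μ₀)

theorem exists_level_measure_lt {δ : ℝ} (hδ : 0 < δ) :
    ∃ n, ∀ K ∈ T.level n, μ₀ K < ENNReal.ofReal δ := by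
  obtain ⟨n, hn⟩ := (T.tendsto_sup_measure.eventually
    (gt_mem_nhds (ENNReal.ofReal_pos.2 hδ))).exists
  exact ⟨n, fun K hK => (le_iSup₂ (f := fun K (_ : K ∈ T.level n) => μ₀ K) K hK).trans_lt hn⟩

/-- Part of any given size of an element of the tree can be approximated by finitely many
elements. -/
theorem exists_finset_sum_mem_Ioc [IsProbabilityMeasure μ₀] {J : Set X} (hJ : J ∈ T.nodes)
    {θ₀ θ₁ : ℝ} (h0 : 0 ≤ θ₀) (h01 : θ₀ < θ₁) (h1 : θ₁ ≤ 1) :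
    ∃ S : Finset (Set X), (∀ K ∈ S, K ∈ T.nodes ∧ K ⊆ J) ∧
      (S : Set (Set X)).Pairwise (AEDisjoint μ₀) ∧
      ∑ K ∈ S, μ₀.real K ∈ Ioc (θ₀ * μ₀.real J) (θ₁ * μ₀.real J) := by
  classical
  have hv := T.measureReal_pos hJ
  have hδ : 0 < (θ₁ - θ₀) * μ₀.real J := mul_pos (sub_pos.2 h01) hv
  obtain ⟨n, hn⟩ := T.exists_level_measure_lt hδ
  have hnr : ∀ K : T.level n, μ₀.real K < (θ₁ - θ₀) * μ₀.real J := fun K =>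
    (ENNReal.toReal_lt_of_lt_ofReal (hn K K.2))
  set g : T.level n → ℝ := fun K => if (K : Set X) ⊆ J then μ₀.real K else 0 with hg
  have hpart : μ₀ J = ∑' K : T.level n, ENNReal.ofReal (g K) := by
    have h := T.lintegral_eq_tsum_level n (J.indicator fun _ => 1)
    rw [lintegral_indicator (T.measurableSet_of_mem J hJ), setLIntegral_one] at h
    rw [h]
    refine tsum_congr fun K => ?_
    have hK := T.level_subset_nodes n K.2
    rw [lintegral_indicator (T.measurableSet_of_mem J hJ), setLIntegral_one,
      Measure.restrict_apply (T.measurableSet_of_mem J hJ)]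
    by_cases hKJ : (K : Set X) ⊆ J
    · simp [hg, hKJ, inter_eq_self_of_subset_right hKJ]
    · simp only [hg, hKJ, if_false, ENNReal.ofReal_zero]
      rcases T.nested_or_aedisjoint hK hJ with h | h | h
      -- The next case, `J ⊆ K`, cannot occur: `K` is smaller than a fraction of `J`.
      · exact absurd h hKJ
      · have h2 : μ₀.real J ≤ μ₀.real K := measureReal_mono h
        have h3 := hnr K
        nlinarith
      · exact h.symm
  have hg0 : ∀ K, 0 ≤ g K := fun K => by
    simp only [hg]
    split_ifs
    exacts [measureReal_nonneg, le_rfl]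
  have hsum : HasSum g (μ₀.real J) := by
    have hfin : ∑' K : T.level n, ENNReal.ofReal (g K) ≠ ∞ := hpart ▸ measure_ne_top _ _
    have hs := (ENNReal.summable_toReal hfin).hasSum
    rw [← ENNReal.tsum_toReal_eq fun _ => ENNReal.ofReal_ne_top, ← hpart] at hs
    simp only [ENNReal.toReal_ofReal (hg0 _)] at hs
    exact hs
  have hlt : θ₀ * μ₀.real J < μ₀.real J := by nlinarith
  obtain ⟨F, hF⟩ := (Tendsto.eventually hsum (lt_mem_nhds hlt)).exists
  obtain ⟨F', hF1, hF2⟩ := Finset.exists_sum_mem_Ioc (b := θ₁ * μ₀.real J)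
    (fun K => by
      simp only [hg]
      split_ifs
      · linarith [hnr K]
      · linarith) (by positivity) F hF
  refine ⟨(F'.image Subtype.val).filter (· ⊆ J), fun K hK => ?_, fun K hK K' hK' hne => ?_, ?_⟩
  · obtain ⟨hK1, hK2⟩ := Finset.mem_filter.1 hK
    obtain ⟨K', -, rfl⟩ := Finset.mem_image.1 hK1
    exact ⟨T.level_subset_nodes n K'.2, hK2⟩
  · obtain ⟨L, -, rfl⟩ := Finset.mem_image.1 (Finset.mem_filter.1 hK).1
    obtain ⟨L', -, rfl⟩ := Finset.mem_image.1 (Finset.mem_filter.1 hK').1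
    exact T.level_pairwise_aedisjoint n L.2 L'.2 hne
  · rw [Finset.sum_filter, Finset.sum_image Subtype.val_injective.injOn]
    exact ⟨hF1, hF2⟩

/-- A competitor living on the element `J`, with average `c`, total square integral `s`, total
mass `y * μ₀ J`, upper bound `1` on the masses and payoff at least `v`. -/
structure IsBlock (J : Set X) (c s y v : ℝ) (φ : X → ℝ) (w : X → ℝ≥0∞) (α : Set X → ℝ≥0) :
    Prop where
  memLp : MemLp φ 2 μ₀
  eq_zero : ∀ x ∉ J, φ x = 0
  integral_eq : ∫ x, φ x ∂μ₀ = c * μ₀.real J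
  integral_sq_eq : ∫ x, φ x ^ 2 ∂μ₀ = s
  measurable : Measurable[T.sigmaAlgebra] w
  alpha_supp : ∀ L ∈ T.nodes, α L ≠ 0 → L ⊆ J
  mass_le : ∀ L ∈ T.nodes, T.mass (μ₀.withDensity w) α L ≤ μ₀ (L ∩ J)
  mass_self : T.mass (μ₀.withDensity w) α J = ENNReal.ofReal (y * μ₀.real J)
  le_payoff : ENNReal.ofReal v ≤
    ∑' L : T.nodes, ENNReal.ofReal (|⨍ t in (L : Set X), φ t ∂μ₀| ^ 2) * α L

/-- The existence of a block with the given data. -/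
def HasBlock (J : Set X) (c s y v : ℝ) : Prop := ∃ φ w α, T.IsBlock J c s y v φ w α

theorem measurableSet_sigmaAlgebra {J : Set X} (hJ : J ∈ T.nodes) :
    MeasurableSet[T.sigmaAlgebra] J :=
  MeasurableSpace.measurableSet_generateFrom hJ

/-- No atoms are used. The constant `c` is perturbed on two children by opposite multiples of their
normalized indicators, which keeps the mean and raises the square integral to any admissible value.
-/
theorem hasBlock_base [IsProbabilityMeasure μ₀] {J : Set X} (hJ : J ∈ T.nodes) {c s y : ℝ}
    (hs : c ^ 2 * μ₀.real J ≤ s) (hy : 0 ≤ y) (hy1 : y ≤ 1) : T.HasBlock J c s y 0 := by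
  obtain ⟨I, hI, I', hI', hne⟩ := T.children_nontrivial J hJ
  have hJm := T.measurableSet_of_mem J hJ
  have hIn := T.children_subset J hJ hI
  have hIn' := T.children_subset J hJ hI'
  have hIJ := T.subset_of_mem_children hJ hI
  have hIJ' := T.subset_of_mem_children hJ hI'
  have hIm := T.measurableSet_of_mem I hIn
  have hIm' := T.measurableSet_of_mem I' hIn'
  have hp := T.measureReal_pos hIn
  have hp' := T.measureReal_pos hIn'
  have hd : μ₀.real (I ∩ I') = 0 :=
    (measureReal_eq_zero_iff).2 (T.children_aedisjoint J hJ hI hI' hne)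
  set a := μ₀.real I with ha
  set a' := μ₀.real I' with ha'
  obtain ⟨τ, hτ⟩ : ∃ τ : ℝ, τ ^ 2 * (a⁻¹ + a'⁻¹) = s - c ^ 2 * μ₀.real J := by
    have h1 : 0 < a⁻¹ + a'⁻¹ := by positivity
    refine ⟨√((s - c ^ 2 * μ₀.real J) / (a⁻¹ + a'⁻¹)), ?_⟩
    rw [Real.sq_sqrt (div_nonneg (sub_nonneg.2 hs) h1.le), div_mul_cancel₀ _ h1.ne']
  set φ : X → ℝ := fun x => J.indicator (fun _ => c) x +
    (I.indicator (fun _ => τ / a) x - I'.indicator (fun _ => τ / a') x) with hφ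
  have ii : ∀ {A : Set X} (r : ℝ), MeasurableSet A → Integrable (A.indicator fun _ => r) μ₀ :=
    fun r hA => (integrable_const r).indicator hA
  have iv : ∀ {A : Set X} (r : ℝ), MeasurableSet A →
      ∫ x, A.indicator (fun _ => r) x ∂μ₀ = r * μ₀.real A := fun r hA => by
    rw [integral_indicator_const _ hA, smul_eq_mul, mul_comm]
  refine ⟨φ, J.indicator fun _ => ENNReal.ofReal y, fun _ => 0, ?_, ?_, ?_, ?_, ?_, ?_, ?_, ?_, ?_⟩
  · have hl : ∀ {A : Set X} (r : ℝ), MeasurableSet A → MemLp (A.indicator fun _ => r) 2 μ₀ :=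
      fun r hA => (memLp_const r).indicator hA
    exact (hl c hJm).add ((hl _ hIm).sub (hl _ hIm'))
  · intro x hx
    have h1 : x ∉ I := fun h => hx (hIJ h)
    have h2 : x ∉ I' := fun h => hx (hIJ' h)
    simp [hφ, hx, h1, h2]
  · have h2 : Integrable (fun x => I.indicator (fun _ => τ / a) x -
        I'.indicator (fun _ => τ / a') x) μ₀ := (ii _ hIm).sub (ii _ hIm')
    simp only [hφ]
    rw [integral_add (ii c hJm) h2, integral_sub (ii _ hIm) (ii _ hIm'), iv c hJm, iv _ hIm,
      iv _ hIm']
    rw [← ha, ← ha', div_mul_cancel₀ _ hp.ne', div_mul_cancel₀ _ hp'.ne']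
    ring
  -- Children may overlap in a null set, so the pointwise identity carries a term on `I ∩ I'`, which
  -- then integrates to zero.
  · have hsq : ∀ x, φ x ^ 2 = J.indicator (fun _ => c ^ 2) x +
        (I.indicator (fun _ => (τ / a) ^ 2 + 2 * c * (τ / a)) x +
        (I'.indicator (fun _ => (τ / a') ^ 2 - 2 * c * (τ / a')) x -
        (I ∩ I').indicator (fun _ => 2 * (τ / a) * (τ / a')) x)) := by
      intro x
      by_cases h1 : x ∈ I <;> by_cases h2 : x ∈ I' <;> by_cases h3 : x ∈ J
      all_goals first
        | exact absurd (hIJ h1) h3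
        | exact absurd (hIJ' h2) h3
        | (simp [hφ, h1, h2, h3]; try ring)
    simp only [hsq]
    have i3 := ii (A := I ∩ I') (2 * (τ / a) * (τ / a')) (hIm.inter hIm')
    have i2 : Integrable (fun x => I'.indicator (fun _ => (τ / a') ^ 2 - 2 * c * (τ / a')) x -
        (I ∩ I').indicator (fun _ => 2 * (τ / a) * (τ / a')) x) μ₀ := (ii _ hIm').sub i3
    have i1 : Integrable (fun x => I.indicator (fun _ => (τ / a) ^ 2 + 2 * c * (τ / a)) x +
        (I'.indicator (fun _ => (τ / a') ^ 2 - 2 * c * (τ / a')) x -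
        (I ∩ I').indicator (fun _ => 2 * (τ / a) * (τ / a')) x)) μ₀ := (ii _ hIm).add i2
    rw [integral_add (ii _ hJm) i1, integral_add (ii _ hIm) i2, integral_sub (ii _ hIm') i3,
      iv _ hJm, iv _ hIm, iv _ hIm', iv _ (hIm.inter hIm'), hd, ← ha, ← ha']
    have e : c ^ 2 * μ₀.real J + τ ^ 2 * (a⁻¹ + a'⁻¹) = s := by rw [hτ]; ring
    rw [← e]
    field_simp
    ring
  · exact measurable_const.indicator (T.measurableSet_sigmaAlgebra hJ)
  · intro L _ h
    exact absurd rfl h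
  · intro L hL
    rw [mass, withDensity_apply _ (T.measurableSet_of_mem L hL),
      lintegral_indicator_const hJm, Measure.restrict_apply hJm]
    simp only [ENNReal.coe_zero, tsum_zero, add_zero]
    rw [inter_comm]
    exact mul_le_of_le_one_left' (ENNReal.ofReal_le_one.2 hy1)
  · rw [mass, withDensity_apply _ hJm, lintegral_indicator_const hJm, Measure.restrict_apply hJm,
      inter_self, ENNReal.ofReal_mul hy, ofReal_measureReal]
    simp
  · simp

end MeasureTree
-- Gluing blocks on smaller elements into a block on `J`.
/-- The function which is `u` on `J` outside the sets of `S`, plus the sum of the functions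
`f K` over `K ∈ S`. -/
noncomputable def glue {X E : Type*} [AddCommMonoid E] (J : Set X) (S : Finset (Set X)) (u : E)
    (f : Set X → X → E) (x : X) : E :=
  (J \ ⋃ K ∈ S, K).indicator (fun _ => u) x + ∑ K ∈ S, f K x

theorem glue_of_mem_diff {X : Type*} {J : Set X} {S : Finset (Set X)} {u : ℝ} {f : Set X → X → ℝ} (hf : ∀ K ∈ S, ∀ x ∉ K, f K x = 0) {x : X}
    (hx : x ∈ J \ ⋃ K ∈ S, K) : glue J S u f x = u := by
  rw [glue, indicator_of_mem hx, Finset.sum_eq_zero, add_zero]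
  exact fun K hK => hf K hK x fun h => hx.2 (mem_biUnion hK h)

theorem glue_of_notMem {X : Type*} {J : Set X} {S : Finset (Set X)} {u : ℝ} {f : Set X → X → ℝ} (hS : ∀ K ∈ S, K ⊆ J)
    (hf : ∀ K ∈ S, ∀ x ∉ K, f K x = 0) {x : X} (hx : x ∉ J) : glue J S u f x = 0 := by
  rw [glue, indicator_of_notMem fun h => hx h.1, Finset.sum_eq_zero, add_zero]
  exact fun K hK => hf K hK x fun h => hx (hS K hK h)

namespace MeasureTree

variable {X : Type*} [MeasurableSpace X] {μ₀ : Measure X} {T : MeasureTree μ₀}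
  {J : Set X} {S : Finset (Set X)}

theorem glue_ae_eq {u : ℝ} {f : Set X → X → ℝ} (hf : ∀ K ∈ S, ∀ x ∉ K, f K x = 0)
    (hd : (S : Set (Set X)).Pairwise (AEDisjoint μ₀)) {K : Set X} (hK : K ∈ S)
    (hKm : MeasurableSet K) : ∀ᵐ x ∂μ₀.restrict K, glue J S u f x = f K x := by
  have h1 : ∀ᵐ x ∂μ₀.restrict K, ∀ K' ∈ S, K' ≠ K → x ∉ K' := by
    rw [Finset.eventually_all]
    intro K' hK'
    by_cases h : K' = K
    · exact Eventually.of_forall fun x hne => absurd h hne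
    · rw [ae_restrict_iff' hKm, ae_iff]
      refine measure_mono_null (fun x hx => ?_) (hd hK' hK h)
      simp only [Classical.not_imp, not_not] at hx
      exact ⟨hx.2.2, hx.1⟩
  filter_upwards [h1, ae_restrict_mem hKm] with x hx hxK
  rw [glue, indicator_of_notMem fun h => h.2 (mem_biUnion hK hxK), zero_add]
  exact Finset.sum_eq_single_of_mem K hK fun K' hK' hne => hf K' hK' x (hx K' hK' hne)

theorem integral_eq_diff_add_sum
    (hS : ∀ K ∈ S, MeasurableSet K ∧ K ⊆ J) (hd : (S : Set (Set X)).Pairwise (AEDisjoint μ₀))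
    {F : X → ℝ} (hF : Integrable F μ₀) (h0 : ∀ x ∉ J, F x = 0) :
    ∫ x, F x ∂μ₀ = (∫ x in J \ ⋃ K ∈ S, K, F x ∂μ₀) + ∑ K ∈ S, ∫ x in K, F x ∂μ₀ := by
  have hU : MeasurableSet (⋃ K ∈ S, K) := Finset.measurableSet_biUnion S fun K hK => (hS K hK).1
  have hUJ : (⋃ K ∈ S, K) ⊆ J := iUnion₂_subset fun K hK => (hS K hK).2
  have h1 : ∫ x in ⋃ K ∈ S, K, F x ∂μ₀ = ∑ K ∈ S, ∫ x in K, F x ∂μ₀ := by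
    have e : (⋃ K ∈ S, K) = ⋃ K : S, (K : Set X) := by rw [iUnion_subtype]
    rw [e, integral_iUnion_ae (s := fun K : {K // K ∈ S} => (K : Set X))
      (fun K => (hS K K.2).1.nullMeasurableSet)
      (fun K K' h => hd K.2 K'.2 (Subtype.coe_injective.ne h)) hF.integrableOn, tsum_fintype]
    exact Finset.sum_coe_sort S fun K => ∫ x in K, F x ∂μ₀
  rw [← setIntegral_eq_integral_of_forall_compl_eq_zero h0, ← h1,
    setIntegral_sdiff hU hF.integrableOn hUJ, sub_add_cancel]

theorem measureReal_diff_biUnion [IsFiniteMeasure μ₀] (hJ : MeasurableSet J)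
    (hS : ∀ K ∈ S, MeasurableSet K ∧ K ⊆ J) (hd : (S : Set (Set X)).Pairwise (AEDisjoint μ₀)) :
    μ₀.real (J \ ⋃ K ∈ S, K) = μ₀.real J - ∑ K ∈ S, μ₀.real K := by
  have h := integral_eq_diff_add_sum hS hd
    ((integrable_const (1 : ℝ)).indicator hJ : Integrable (J.indicator fun _ => (1 : ℝ)) μ₀)
    (fun x hx => indicator_of_notMem hx _)
  have h1 : ∀ {A : Set X}, A ⊆ J → ∫ x in A, J.indicator (fun _ => (1 : ℝ)) x ∂μ₀ = μ₀.real A := by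
    intro A hA
    rw [setIntegral_indicator hJ, inter_eq_self_of_subset_left hA]
    simp
  rw [h1 sdiff_subset, Finset.sum_congr rfl fun K hK => h1 (hS K hK).2,
    integral_indicator_const _ hJ, smul_eq_mul, mul_one] at h
  linarith

/-- The new ingredients are an atom `β` at `J` and the density `κ` on the remainder. The atom counts
only for elements containing `J`, which contain the entire remainder, so `hβ` suffices for the mass
bound everywhere. Averages over elements carrying old atoms are unchanged, hence payoffs add. -/
theorem hasBlock_glue [IsProbabilityMeasure μ₀] (hJ : J ∈ T.nodes)
    (hS : ∀ K ∈ S, K ∈ T.nodes ∧ K ⊆ J) (hd : (S : Set (Set X)).Pairwise (AEDisjoint μ₀))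
    {c c' u y : ℝ} {s v : Set X → ℝ} {β κ : ℝ≥0} (hv : ∀ K ∈ S, 0 ≤ v K)
    (hb : ∀ K ∈ S, T.HasBlock K c' (s K) 1 (v K)) (hκ : κ ≤ 1)
    (hβ : β + κ * (μ₀.real J - ∑ K ∈ S, μ₀.real K) ≤ μ₀.real J - ∑ K ∈ S, μ₀.real K)
    (hc : u * (μ₀.real J - ∑ K ∈ S, μ₀.real K) + c' * ∑ K ∈ S, μ₀.real K = c * μ₀.real J)
    (hy : β + κ * (μ₀.real J - ∑ K ∈ S, μ₀.real K) + ∑ K ∈ S, μ₀.real K = y * μ₀.real J) :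
    T.HasBlock J c (u ^ 2 * (μ₀.real J - ∑ K ∈ S, μ₀.real K) + ∑ K ∈ S, s K) y
      (c ^ 2 * β + ∑ K ∈ S, v K) := by
  classical
  choose! φ w α hB using hb
  have hJm := T.measurableSet_of_mem J hJ
  have hJv := T.measureReal_pos hJ
  have hSm : ∀ K ∈ S, MeasurableSet K ∧ K ⊆ J := fun K hK =>
    ⟨T.measurableSet_of_mem K (hS K hK).1, (hS K hK).2⟩
  have hUm : MeasurableSet[T.sigmaAlgebra] (J \ ⋃ K ∈ S, K) :=
    (T.measurableSet_sigmaAlgebra hJ).diff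
      (Finset.measurableSet_biUnion S fun K hK => T.measurableSet_sigmaAlgebra (hS K hK).1)
  have hUm' : MeasurableSet (J \ ⋃ K ∈ S, K) := T.sigmaAlgebra_le _ hUm
  have hf : ∀ K ∈ S, ∀ x ∉ K, φ K x = 0 := fun K hK => (hB K hK).eq_zero
  have hU := measureReal_diff_biUnion hJm hSm hd
  set r := μ₀.real J - ∑ K ∈ S, μ₀.real K with hr
  have hr0 : 0 ≤ r := hU ▸ measureReal_nonneg
  have hLp : MemLp (glue J S u φ) 2 μ₀ := by
    refine MemLp.add ((memLp_const u).indicator hUm') ?_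
    exact memLp_finsetSum S fun K hK => (hB K hK).memLp
  have hint : ∀ K ∈ S, ∀ A ⊆ K, ∫ x in A, glue J S u φ x ∂μ₀ = ∫ x in A, φ K x ∂μ₀ :=
    fun K hK A hA => integral_congr_ae
      (ae_restrict_of_ae_restrict_of_subset hA (glue_ae_eq hf hd hK (hSm K hK).1))
  have hgint : ∫ x, glue J S u φ x ∂μ₀ = c * μ₀.real J := by
    rw [integral_eq_diff_add_sum hSm hd (hLp.integrable one_le_two)
      fun x hx => glue_of_notMem (fun K hK => (hS K hK).2) hf hx, ← hc,
      setIntegral_congr_fun hUm' fun x hx => glue_of_mem_diff hf hx, setIntegral_const, hU,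
      smul_eq_mul, mul_comm r, Finset.mul_sum]
    congr 1
    refine Finset.sum_congr rfl fun K hK => ?_
    rw [hint K hK K Subset.rfl, setIntegral_eq_integral_of_forall_compl_eq_zero (hf K hK),
      (hB K hK).integral_eq]
  have hmass : ∀ L, MeasurableSet L →
      T.mass (μ₀.withDensity (glue J S (κ : ℝ≥0∞) w))
        (fun L => (if L = J then β else 0) + ∑ K ∈ S, α K L) L =
      (∑' I : T.below L, ((if (I : Set X) = J then β else 0 : ℝ≥0) : ℝ≥0∞)) +
        κ * μ₀ (L ∩ (J \ ⋃ K ∈ S, K)) +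
        ∑ K ∈ S, T.mass (μ₀.withDensity (w K)) (α K) L := by
    intro L hL
    have h1 : μ₀.withDensity (glue J S (κ : ℝ≥0∞) w) L = κ * μ₀ (L ∩ (J \ ⋃ K ∈ S, K)) +
        ∑ K ∈ S, μ₀.withDensity (w K) L := by
      simp only [withDensity_apply _ hL, glue]
      rw [lintegral_add_left (measurable_const.indicator hUm'),
        lintegral_indicator_const hUm', Measure.restrict_apply hUm', inter_comm L,
        lintegral_finsetSum' _ fun K hK =>
          ((hB K hK).measurable.mono T.sigmaAlgebra_le le_rfl).aemeasurable]
    simp only [mass, h1, ENNReal.coe_add, ENNReal.ofNNReal_finsetSum, Finset.sum_add_distrib]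
    rw [ENNReal.tsum_add, Summable.tsum_finsetSum fun _ _ => ENNReal.summable]
    ring
  have hβ' : (β : ℝ≥0∞) + κ * μ₀ (J \ ⋃ K ∈ S, K) ≤ μ₀ (J \ ⋃ K ∈ S, K) := by
    rw [← ofReal_measureReal (s := J \ ⋃ K ∈ S, K), hU, ← ENNReal.ofReal_coe_nnreal,
      ← ENNReal.ofReal_coe_nnreal, ← ENNReal.ofReal_mul κ.coe_nonneg,
      ← ENNReal.ofReal_add β.coe_nonneg (by positivity)]
    exact ENNReal.ofReal_le_ofReal hβ
  have hβJ : ∀ L, J ⊆ L → ∑' I : T.below L, ((if (I : Set X) = J then β else 0 : ℝ≥0) : ℝ≥0∞)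
      = β := by
    intro L hL
    rw [tsum_eq_single ⟨J, hJ, hL⟩ fun I hI => ?_, if_pos rfl]
    rw [if_neg fun h => hI (Subtype.ext h), ENNReal.coe_zero]
  have hβ0 : ∀ L, ¬ J ⊆ L → ∑' I : T.below L, ((if (I : Set X) = J then β else 0 : ℝ≥0) : ℝ≥0∞)
      = 0 := by
    refine fun L hL => ENNReal.tsum_eq_zero.2 fun I => ?_
    have : (I : Set X) ≠ J := fun h => hL (h ▸ I.2.2)
    rw [if_neg this, ENNReal.coe_zero]
  have hsplit : ∀ L, MeasurableSet L → μ₀ (L ∩ J) =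
      μ₀ (L ∩ (J \ ⋃ K ∈ S, K)) + ∑ K ∈ S, μ₀ (L ∩ K) := by
    intro L hL
    have e1 : μ₀ (L ∩ ⋃ K ∈ S, K) = ∑ K ∈ S, μ₀ (L ∩ K) := by
      rw [inter_iUnion₂]
      exact measure_biUnion_finset₀
        (fun K hK K' hK' h => (hd hK hK' h).mono inter_subset_right inter_subset_right)
        fun K hK => (hL.inter (hSm K hK).1).nullMeasurableSet
    rw [← e1, ← measure_inter_add_sdiff (L ∩ J)
      (Finset.measurableSet_biUnion S fun K hK => (hSm K hK).1), add_comm]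
    congr 2
    · ext x
      simp only [Set.mem_sdiff, mem_inter_iff]
      tauto
    · have hUJ : (⋃ K ∈ S, K) ⊆ J := iUnion₂_subset fun K hK => (hSm K hK).2
      rw [inter_assoc, inter_eq_self_of_subset_right hUJ]
  refine ⟨glue J S u φ, glue J S (κ : ℝ≥0∞) w,
    fun L => (if L = J then β else 0) + ∑ K ∈ S, α K L, hLp,
    fun x hx => glue_of_notMem (fun K hK => (hS K hK).2) hf hx, ?_, ?_, ?_, ?_, ?_, ?_, ?_⟩
  · exact hgint
  · rw [integral_eq_diff_add_sum hSm hd hLp.integrable_sq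
      fun x hx => by rw [glue_of_notMem (fun K hK => (hS K hK).2) hf hx, zero_pow two_ne_zero],
      setIntegral_congr_fun (g := fun _ => u ^ 2) hUm' fun x hx => by
        simp only [glue_of_mem_diff hf hx],
      setIntegral_const, hU, smul_eq_mul, mul_comm r]
    congr 1
    refine Finset.sum_congr rfl fun K hK => ?_
    have hae : ∀ᵐ x ∂μ₀.restrict K, glue J S u φ x ^ 2 = φ K x ^ 2 :=
      (glue_ae_eq hf hd hK (hSm K hK).1).mono fun x hx => by rw [hx]
    rw [integral_congr_ae hae, setIntegral_eq_integral_of_forall_compl_eq_zero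
      fun x hx => by rw [hf K hK x hx, zero_pow two_ne_zero], (hB K hK).integral_sq_eq]
  · exact Measurable.add (measurable_const.indicator hUm)
      (Finset.measurable_fun_sum S fun K hK => (hB K hK).measurable)
  · intro L hL h
    by_cases hLJ : L = J
    · exact hLJ.le
    · rw [if_neg hLJ, zero_add] at h
      obtain ⟨K, hK, hne⟩ := Finset.exists_ne_zero_of_sum_ne_zero h
      exact ((hB K hK).alpha_supp L hL hne).trans (hS K hK).2
  · intro L hL
    have hLm := T.measurableSet_of_mem L hL
    rw [hmass L hLm, hsplit L hLm]
    gcongr with K hK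
    · by_cases h : J ⊆ L
      · have e : L ∩ (J \ ⋃ K ∈ S, K) = J \ ⋃ K ∈ S, K :=
          inter_eq_self_of_subset_right (sdiff_subset.trans h)
        rw [hβJ L h, e]
        exact hβ'
      · rw [hβ0 L h, zero_add]
        exact mul_le_of_le_one_left' (ENNReal.coe_le_one_iff.2 hκ)
    · exact (hB K hK).mass_le L hL
  · have e : J ∩ (J \ ⋃ K ∈ S, K) = J \ ⋃ K ∈ S, K :=
      inter_eq_self_of_subset_right sdiff_subset
    have h1 : ∀ K ∈ S, T.mass (μ₀.withDensity (w K)) (α K) J = ENNReal.ofReal (μ₀.real K) := by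
      intro K hK
      refine le_antisymm ?_ ?_
      · have := (hB K hK).mass_le J hJ
        rwa [inter_eq_self_of_subset_right (hS K hK).2, ← ofReal_measureReal] at this
      · have := (hB K hK).mass_self
        rw [one_mul] at this
        rw [← this]
        exact add_le_add (measure_mono (hS K hK).2)
          (ENNReal.tsum_mono_subtype (fun L => (α K L : ℝ≥0∞))
            fun I (hI : I ∈ T.below K) => ⟨hI.1, hI.2.trans (hS K hK).2⟩)
    rw [hmass J hJm, hβJ J Subset.rfl, e, Finset.sum_congr rfl h1,
      ← ENNReal.ofReal_sum_of_nonneg fun K _ => measureReal_nonneg,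
      ← ofReal_measureReal (s := J \ ⋃ K ∈ S, K), hU, ← ENNReal.ofReal_coe_nnreal,
      ← ENNReal.ofReal_coe_nnreal, ← ENNReal.ofReal_mul κ.coe_nonneg,
      ← ENNReal.ofReal_add β.coe_nonneg (by positivity),
      ← ENNReal.ofReal_add (by positivity) (Finset.sum_nonneg fun K _ => measureReal_nonneg), hy]
  · have hJint : ∫ x in J, glue J S u φ x ∂μ₀ = c * μ₀.real J := by
      rw [setIntegral_eq_integral_of_forall_compl_eq_zero
        fun x hx => glue_of_notMem (fun K hK => (hS K hK).2) hf hx, hgint]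
    have h1 : ∑' L : T.nodes, ENNReal.ofReal (|⨍ t in (L : Set X), glue J S u φ t ∂μ₀| ^ 2) *
        ((if (L : Set X) = J then β else 0 : ℝ≥0) : ℝ≥0∞) = ENNReal.ofReal (c ^ 2 * β) := by
      rw [tsum_eq_single (⟨J, hJ⟩ : T.nodes) fun I hI => ?_, if_pos rfl]
      · rw [setAverage_eq_div, hJint, mul_div_cancel_right₀ _ hJv.ne', sq_abs,
          ENNReal.ofReal_mul (sq_nonneg c), ENNReal.ofReal_coe_nnreal]
      · rw [if_neg fun h => hI (Subtype.ext h), ENNReal.coe_zero, mul_zero]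
    have h2 : ∀ K ∈ S, ENNReal.ofReal (v K) ≤ ∑' L : T.nodes,
        ENNReal.ofReal (|⨍ t in (L : Set X), glue J S u φ t ∂μ₀| ^ 2) * α K L := by
      intro K hK
      refine (hB K hK).le_payoff.trans (le_of_eq (tsum_congr fun L => ?_))
      by_cases h : α K L = 0
      · simp [h]
      · rw [setAverage_eq_div, setAverage_eq_div,
          hint K hK L ((hB K hK).alpha_supp L L.2 h)]
    simp only [ENNReal.coe_add, ENNReal.ofNNReal_finsetSum, mul_add, Finset.mul_sum]
    rw [ENNReal.tsum_add, Summable.tsum_finsetSum fun _ _ => ENNReal.summable, h1,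
      ENNReal.ofReal_add (by positivity) (Finset.sum_nonneg hv), ENNReal.ofReal_sum_of_nonneg hv]
    gcongr with K hK
    exact h2 K hK

end MeasureTree
-- Self-similar blocks of full mass.
namespace MeasureTree

variable {X : Type*} [MeasurableSpace X] {μ₀ : Measure X} {T : MeasureTree μ₀}

theorem HasBlock.mono {J : Set X} {c s y v v' : ℝ} (h : T.HasBlock J c s y v) (hv : v' ≤ v) :
    T.HasBlock J c s y v' := by
  obtain ⟨φ, w, α, hb⟩ := h
  exact ⟨φ, w, α, { hb with le_payoff := (ENNReal.ofReal_le_ofReal hv).trans hb.le_payoff }⟩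

/-- On all elements there are blocks of full mass with square average `c ^ 2 * W` and payoff
`c ^ 2 * V` per unit of measure. -/
def HasBlocks (T : MeasureTree μ₀) (W V : ℝ) : Prop :=
  ∀ J ∈ T.nodes, ∀ c s : ℝ, c ^ 2 * W * μ₀.real J ≤ s → T.HasBlock J c s 1 (c ^ 2 * V * μ₀.real J)

theorem HasBlocks.mono {W V V' : ℝ} (h : T.HasBlocks W V) (hV : V' ≤ V) : T.HasBlocks W V' :=
  fun J hJ c s hs => (h J hJ c s hs).mono (by gcongr)

theorem hasBlocks_zero [IsProbabilityMeasure μ₀] {W : ℝ} (hW : 1 ≤ W) : T.HasBlocks W 0 := by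
  intro J hJ c s hs
  rw [mul_zero, zero_mul]
  refine T.hasBlock_base hJ (le_trans ?_ hs) zero_le_one le_rfl
  gcongr
  exact le_mul_of_one_le_right (sq_nonneg c) hW

/-- The square integral left over by the remainder is distributed among the elements of `S` in
proportion to their measure. -/
theorem HasBlocks.glue [IsProbabilityMeasure μ₀] {W V : ℝ} (h : T.HasBlocks W V) (hV : 0 ≤ V)
    {J : Set X} (hJ : J ∈ T.nodes) {S : Finset (Set X)} (hS : ∀ K ∈ S, K ∈ T.nodes ∧ K ⊆ J)
    (hd : (S : Set (Set X)).Pairwise (AEDisjoint μ₀)) {c c' u y s r l : ℝ} {β κ : ℝ≥0}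
    (hl : ∑ K ∈ S, μ₀.real K = l) (hl0 : 0 < l) (hr : μ₀.real J - l = r) (hκ : κ ≤ 1)
    (hβ : β + κ * r ≤ r) (hc : u * r + c' * l = c * μ₀.real J)
    (hy : β + κ * r + l = y * μ₀.real J) (hs : c' ^ 2 * W * l + u ^ 2 * r ≤ s) :
    T.HasBlock J c s y (c ^ 2 * β + c' ^ 2 * V * l) := by
  subst hr hl
  set l := ∑ K ∈ S, μ₀.real K with hl
  have key := hasBlock_glue (c := c) (c' := c') (u := u) (y := y) (β := β) (κ := κ)
    (s := fun K => (s - u ^ 2 * (μ₀.real J - l)) * (μ₀.real K / l))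
    (v := fun K => c' ^ 2 * V * μ₀.real K) hJ hS hd (fun K _ => by positivity)
    (fun K hK => h K (hS K hK).1 c' _ ?_) hκ hβ hc hy
  · rw [← Finset.mul_sum, ← Finset.mul_sum, ← Finset.sum_div, ← hl, div_self hl0.ne', mul_one,
      add_sub_cancel] at key
    exact key
  · calc c' ^ 2 * W * μ₀.real K = c' ^ 2 * W * l * (μ₀.real K / l) := by field_simp
      _ ≤ (s - u ^ 2 * (μ₀.real J - l)) * (μ₀.real K / l) := by
        have : 0 ≤ μ₀.real K := measureReal_nonneg
        gcongr
        linarith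

/-- To first order in the remainder `r`, the corrected average satisfies `c'² l ≈ c² (v - (2b - 1)
r)`. The payoff constant thus changes by `1 - (2b - 1) V` per unit of `r / v`, with fixed point `V =
1 / (2b - 1)`; likewise `W` has the fixed point `b² / (2b - 1)`. -/
theorem HasBlocks.step [IsProbabilityMeasure μ₀] {b W V : ℝ} (hb : 1 / 2 < b)
    (hW1 : 1 ≤ W) (hW : b ^ 2 < (2 * b - 1) * W) (hV0 : 0 ≤ V) (hV : (2 * b - 1) * V ≤ 1)
    (h : T.HasBlocks W V) :
    T.HasBlocks W
      (V + ((2 * b - 1) * W - b ^ 2) / (b ^ 2 * W) / 2 * (1 - (2 * b - 1) * V)) := by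
  intro J hJ c s hs
  have hv := T.measureReal_pos hJ
  have hb0 : 0 < b := by linarith
  have hW0 : 0 < W := by linarith
  -- The largest fraction `r / v` for which the estimate below keeps the square average under `c²
  -- W`. Choosing `r ≥ ε v / 2` guarantees the gain.
  set ε := ((2 * b - 1) * W - b ^ 2) / (b ^ 2 * W) with hε
  have hε0 : 0 < ε := div_pos (by linarith) (by positivity)
  have hεW : ε * (b ^ 2 * W) = (2 * b - 1) * W - b ^ 2 := div_mul_cancel₀ _ (by positivity)
  have hε1 : ε < 1 := by
    rw [hε, div_lt_one (by positivity)]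
    nlinarith [sq_nonneg (b - 1)]
  obtain ⟨S, hS, hd, hS1, hS2⟩ := T.exists_finset_sum_mem_Ioc hJ (θ₀ := 1 - ε) (θ₁ := 1 - ε / 2)
    (by linarith) (by linarith) (by linarith)
  set v := μ₀.real J
  obtain ⟨l, hl⟩ : ∃ l, ∑ K ∈ S, μ₀.real K = l := ⟨_, rfl⟩
  rw [hl] at hS1 hS2
  obtain ⟨r, hr⟩ : ∃ r, v - l = r := ⟨_, rfl⟩
  have hl0 : 0 < l := lt_of_le_of_lt (by nlinarith) hS1
  have hr1 : ε / 2 * v ≤ r := by linarith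
  have hr2 : r ≤ ε * v := by linarith
  have hr0 : 0 ≤ r := le_trans (by positivity) hr1
  have hlr : v = l + r := by linarith
  have hc' : ((c * v - b * c * r) / l) ^ 2 * l = c ^ 2 * ((v - b * r) ^ 2 / l) := by
    field_simp
  have key := h.glue hV0 hJ hS hd (c := c) (c' := (c * v - b * c * r) / l) (u := b * c) (y := 1)
    (s := s) (β := r.toNNReal) (κ := 0) hl hl0 hr zero_le_one
    (by simp [Real.coe_toNNReal r hr0]) (by field_simp; ring)
    (by rw [Real.coe_toNNReal r hr0]; simp; linarith)
    (by
      refine le_trans ?_ hs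
      have h1 : (v - b * r) ^ 2 / l * W + b ^ 2 * r ≤ W * v := by
        rw [div_mul_eq_mul_div, div_add' _ _ _ hl0.ne', div_le_iff₀ hl0]
        have h2 : b ^ 2 * l + b ^ 2 * W * r ≤ (2 * b - 1) * W * v := by
          have : b ^ 2 * W * r ≤ b ^ 2 * W * (ε * v) := by gcongr
          nlinarith
        rw [hlr] at h2 ⊢
        nlinarith [mul_le_mul_of_nonneg_left h2 hr0]
      calc ((c * v - b * c * r) / l) ^ 2 * W * l + (b * c) ^ 2 * r
          = c ^ 2 * ((v - b * r) ^ 2 / l * W + b ^ 2 * r) := by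
            rw [mul_right_comm, hc']; ring
        _ ≤ c ^ 2 * (W * v) := by gcongr
        _ = c ^ 2 * W * v := by ring)
  refine key.mono ?_
  rw [Real.coe_toNNReal r hr0, mul_right_comm _ V l, hc']
  have h1 : v - (2 * b - 1) * r ≤ (v - b * r) ^ 2 / l := by
    rw [le_div_iff₀ hl0, hlr]
    nlinarith [mul_nonneg (sq_nonneg r) (sq_nonneg (b - 1))]
  have h2 : (V + ε / 2 * (1 - (2 * b - 1) * V)) * v ≤ r + (v - b * r) ^ 2 / l * V := by
    nlinarith [mul_le_mul_of_nonneg_right h1 hV0,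
      mul_le_mul_of_nonneg_right hr1 (sub_nonneg.2 hV)]
  calc c ^ 2 * (V + ε / 2 * (1 - (2 * b - 1) * V)) * v
      = c ^ 2 * ((V + ε / 2 * (1 - (2 * b - 1) * V)) * v) := by ring
    _ ≤ c ^ 2 * (r + (v - b * r) ^ 2 / l * V) := by gcongr
    _ = c ^ 2 * r + c ^ 2 * ((v - b * r) ^ 2 / l) * V := by ring

/-- Starting from payoff zero, each step gains at least a fixed `δ` until `V` is reached, since the
gain is smallest at `V` itself. -/
theorem hasBlocks_of_lt [IsProbabilityMeasure μ₀] {b W V : ℝ} (hb : 1 / 2 < b)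
    (hW : b ^ 2 < (2 * b - 1) * W) (hV0 : 0 ≤ V) (hV : (2 * b - 1) * V < 1) :
    T.HasBlocks W V := by
  have hd : 0 < 2 * b - 1 := by linarith
  have hW1 : 1 ≤ W := by
    by_contra! h
    nlinarith [sq_nonneg (b - 1)]
  set ε := ((2 * b - 1) * W - b ^ 2) / (b ^ 2 * W) / 2 with hε
  have hε0 : 0 < ε := div_pos (div_pos (by linarith) (by positivity)) two_pos
  set δ := ε * (1 - (2 * b - 1) * V) with hδ
  have hδ0 : 0 < δ := mul_pos hε0 (by linarith)
  have hind : ∀ n : ℕ, T.HasBlocks W (min V (n * δ)) := by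
    intro n
    induction n with
    | zero => simpa [hV0] using hasBlocks_zero (T := T) hW1
    | succ n ih =>
      have h0 : 0 ≤ min V (n * δ) := le_min hV0 (by positivity)
      have h1 : (2 * b - 1) * min V (n * δ) ≤ (2 * b - 1) * V := by
        gcongr
        exact min_le_left _ _
      refine (ih.step hb hW1 hW h0 (by linarith)).mono ?_
      have h2 : δ ≤ ε * (1 - (2 * b - 1) * min V (n * δ)) := by
        rw [hδ]
        gcongr
      refine le_trans ?_ (add_le_add_right h2 _)
      rw [← min_add_add_right]
      refine min_le_min (by linarith) (le_of_eq ?_)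
      push_cast
      ring
  obtain ⟨n, hn⟩ := exists_nat_ge (V / δ)
  have := hind n
  rwa [min_eq_left ((div_le_iff₀ hδ0).1 hn)] at this

/-- The proportion `θ` depends only on the tree and the window, so the block parameters and `c`, `u`
may be chosen after it. The mass `y - θ` not carried by blocks is spread as a constant density on
the remainder. -/
theorem exists_hasBlock_univ [IsProbabilityMeasure μ₀] (T : MeasureTree μ₀) {θ₀ θ₁ y : ℝ}
    (h0 : 0 ≤ θ₀) (h01 : θ₀ < θ₁) (h1y : θ₁ ≤ y) (hy : y ≤ 1) :
    ∃ θ ∈ Ioc θ₀ θ₁, ∀ W V c u x₁ x₂ : ℝ, T.HasBlocks W V → 0 ≤ V → u * (1 - θ) + c * θ = x₁ →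
      c ^ 2 * W * θ + u ^ 2 * (1 - θ) ≤ x₂ → T.HasBlock univ x₁ x₂ y (c ^ 2 * V * θ) := by
  obtain ⟨S, hS, hd, hθ⟩ := T.exists_finset_sum_mem_Ioc T.univ_mem h0 h01 (h1y.trans hy)
  rw [probReal_univ, mul_one, mul_one] at hθ
  refine ⟨_, hθ, fun W V c u x₁ x₂ hb hV hx₁ hx₂ => ?_⟩
  set θ := ∑ K ∈ S, μ₀.real K with hθd
  have hθy : θ ≤ y := hθ.2.trans h1y
  have hθ1 : θ ≤ 1 := hθy.trans hy
  have hκ0 : 0 ≤ (y - θ) / (1 - θ) := div_nonneg (by linarith) (by linarith)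
  have hκ1 : (y - θ) / (1 - θ) ≤ 1 := div_le_one_of_le₀ (by linarith) (by linarith)
  have hκ : (y - θ) / (1 - θ) * (1 - θ) = y - θ := by
    -- If `θ = 1` then `y = 1` as well, and both sides vanish.
    rcases hθ1.eq_or_lt with h | h
    · rw [h, sub_self, mul_zero]
      linarith
    · exact div_mul_cancel₀ _ (sub_pos.2 h).ne'
  have key := hb.glue hV T.univ_mem hS hd (c := x₁) (c' := c) (u := u) (y := y) (s := x₂)
    (β := 0) (κ := ((y - θ) / (1 - θ)).toNNReal) hθd.symm (h0.trans_lt hθ.1) rfl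
    (Real.toNNReal_le_one.2 hκ1)
    (by
      rw [probReal_univ, Real.coe_toNNReal _ hκ0, hκ, NNReal.coe_zero]
      linarith)
    (by rw [probReal_univ, mul_one, hx₁])
    (by
      rw [probReal_univ, Real.coe_toNNReal _ hκ0, hκ, NNReal.coe_zero]
      ring)
    (by rwa [probReal_univ])
  simpa using key

/-- Undoes the normalization by adding `m μ₀` to `(M - m)` times the block; the added measure
contributes the term `m x₂`. -/
theorem HasBlock.exists_isCompetitor [IsProbabilityMeasure μ₀] {m M x₁ x₂ x₃ y v : ℝ}
    (h : T.HasBlock univ x₁ x₂ y v) (hm : 0 ≤ m) (hmM : m ≤ M) (hy : 0 ≤ y)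
    (hx₃ : x₃ = m + (M - m) * y) :
    ∃ φ μ α, T.IsCompetitor m M x₁ x₂ x₃ φ μ α ∧
      ENNReal.ofReal ((M - m) * v + m * x₂) ≤ T.payoff φ μ α := by
  obtain ⟨φ, w, α, hb⟩ := h
  have hMm := sub_nonneg.2 hmM
  have hwm : Measurable w := hb.measurable.mono T.sigmaAlgebra_le le_rfl
  set μ := μ₀.withDensity fun x => ENNReal.ofReal m + ENNReal.ofReal (M - m) * w x with hμ
  set α' : Set X → ℝ≥0 := fun L => (M - m).toNNReal * α L with hα'
  have hmass : ∀ L, MeasurableSet L → T.mass μ α' L =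
      ENNReal.ofReal m * μ₀ L + ENNReal.ofReal (M - m) * T.mass (μ₀.withDensity w) α L := by
    intro L hL
    simp only [mass, hμ, hα', withDensity_apply _ hL, ENNReal.coe_mul, ENNReal.tsum_mul_left]
    rw [lintegral_add_left measurable_const, setLIntegral_const, lintegral_const_mul _ hwm,
      mul_add, add_assoc]
    rfl
  have hI : ∫ x, φ x ∂μ₀ = x₁ := by rw [hb.integral_eq, probReal_univ, mul_one]
  have hMofReal : ENNReal.ofReal m + ENNReal.ofReal (M - m) = ENNReal.ofReal M := by
    rw [← ENNReal.ofReal_add hm hMm, add_sub_cancel]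
  refine ⟨φ, μ, α', ⟨hb.memLp, ⟨_, measurable_const.add (hb.measurable.const_mul _), rfl⟩,
    ?_, ?_, ?_, ?_, ?_⟩, ?_⟩
  · rw [setAverage_eq_div, setIntegral_univ, hI, probReal_univ, div_one]
  · rw [setAverage_eq_div, setIntegral_univ, hb.integral_sq_eq, probReal_univ, div_one]
  · have := hmass univ MeasurableSet.univ
    rw [hb.mass_self, mass, T.below_univ, probReal_univ, measure_univ (μ := μ₀), mul_one, mul_one,
      ← ENNReal.ofReal_mul hMm, ← ENNReal.ofReal_add hm (by positivity)] at this
    rw [this, hx₃]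
  · intro J hJ
    exact le_self_add.trans_eq (hmass J (T.measurableSet_of_mem J hJ)).symm
  · intro J hJ
    refine (hmass J (T.measurableSet_of_mem J hJ)).le.trans ?_
    rw [← hMofReal, add_mul]
    gcongr
    have := hb.mass_le J hJ
    rwa [inter_univ] at this
  · rw [payoff, add_comm (_ * v)]
    refine (ENNReal.ofReal_add_le).trans (add_le_add ?_ ?_)
    · have hae : AEMeasurable (fun x => ENNReal.ofReal (|φ x| ^ 2)) μ₀ :=
        (hb.memLp.aestronglyMeasurable.aemeasurable.abs.pow_const 2).ennreal_ofReal
      have hwm' : Measurable fun x => ENNReal.ofReal m + ENNReal.ofReal (M - m) * w x :=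
        measurable_const.add (hwm.const_mul _)
      rw [ENNReal.ofReal_mul hm, hμ,
        lintegral_withDensity_eq_lintegral_mul₀ hwm'.aemeasurable hae, ← hb.integral_sq_eq,
        ← setIntegral_univ, ← setLIntegral_sq_eq hb.memLp, setLIntegral_univ,
        ← lintegral_const_mul'' _ hae]
      refine lintegral_mono fun x => ?_
      simp only [Pi.mul_apply]
      gcongr
      exact le_self_add
    · rw [ENNReal.ofReal_mul hMm]
      refine (mul_le_mul_right hb.le_payoff _).trans (le_of_eq ?_)
      rw [← ENNReal.tsum_mul_left]
      refine tsum_congr fun L => ?_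
      simp only [hα', ENNReal.coe_mul]
      rw [mul_left_comm]
      rfl

theorem HasBlock.le_bellman [IsProbabilityMeasure μ₀] {m M x₁ x₂ x₃ y v : ℝ}
    (h : T.HasBlock univ x₁ x₂ y v) (hm : 0 ≤ m) (hmM : m ≤ M) (hy : 0 ≤ y)
    (hx₃ : x₃ = m + (M - m) * y) :
    (((M - m) * v + m * x₂ : ℝ) : EReal) ≤ T.bellman m M x₁ x₂ x₃ := by
  obtain ⟨φ, μ, α, hc, hp⟩ := h.exists_isCompetitor hm hmM hy hx₃
  refine le_trans ?_ (le_sSup ⟨φ, μ, α, hc, rfl⟩)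
  refine le_trans ?_ (EReal.coe_ennreal_le_coe_ennreal_iff.2 hp)
  rw [EReal.coe_ennreal_ofReal]
  exact EReal.coe_le_coe_iff.2 (le_max_left _ _)

theorem bellman_le [IsProbabilityMeasure μ₀] {m M x₁ x₂ x₃ R : ℝ} (hR : 0 ≤ R)
    (h : ∀ φ μ α, T.IsCompetitor m M x₁ x₂ x₃ φ μ α → T.payoff φ μ α ≤ ENNReal.ofReal R) :
    T.bellman m M x₁ x₂ x₃ ≤ (R : EReal) := by
  refine sSup_le ?_
  rintro _ ⟨φ, μ, α, hc, rfl⟩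
  refine (EReal.coe_ennreal_le_coe_ennreal_iff.2 (h φ μ α hc)).trans (le_of_eq ?_)
  rw [EReal.coe_ennreal_ofReal, max_eq_left hR]

end MeasureTree
-- Optimal competitors and the value of the Bellman function.
namespace MeasureTree

variable {X : Type*} [MeasurableSpace X] {μ₀ : Measure X}

/-- The hypotheses are the strict constraints for the ideal values `θ = y`, `W = b² / (2b - 1)`, `V
= 1 / (2b - 1)`, none of which need be attained. They survive a small perturbation, by continuity in
the pair (error, `θ`). -/
theorem hasBlock_univ_of_lt [IsProbabilityMeasure μ₀] (T : MeasureTree μ₀) {b x₁ x₂ y v : ℝ}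
    (hb : 1 / 2 < b) (hy : 0 < y) (hy1 : y ≤ 1)
    (hx : (x₁ / (y + (1 - y) * b)) ^ 2 * (b ^ 2 / (2 * b - 1)) * y +
      (b * (x₁ / (y + (1 - y) * b))) ^ 2 * (1 - y) < x₂)
    (hv : v < (x₁ / (y + (1 - y) * b)) ^ 2 * (1 / (2 * b - 1)) * y) :
    T.HasBlock univ x₁ x₂ y v := by
  have hd : 0 < 2 * b - 1 := by linarith
  have hden : ∀ θ : ℝ, 0 ≤ θ → θ ≤ 1 → 0 < θ + (1 - θ) * b := fun θ h0 h1 => by nlinarith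
  have hden_y := (hden y hy.le hy1).ne'
  have hc : ContinuousAt (fun p : ℝ × ℝ => x₁ / (p.2 + (1 - p.2) * b)) (0, y) :=
    ContinuousAt.div (by fun_prop) (by fun_prop) hden_y
  have h1 : ContinuousAt (fun p : ℝ × ℝ =>
      (x₁ / (p.2 + (1 - p.2) * b)) ^ 2 * (b ^ 2 / (2 * b - 1) + p.1) * p.2 +
      (b * (x₁ / (p.2 + (1 - p.2) * b))) ^ 2 * (1 - p.2)) (0, y) := by fun_prop
  have h2 : ContinuousAt (fun p : ℝ × ℝ =>
      (x₁ / (p.2 + (1 - p.2) * b)) ^ 2 * (1 / (2 * b - 1) - p.1) * p.2) (0, y) := by fun_prop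
  have h3 : ContinuousAt (fun p : ℝ × ℝ => 1 / (2 * b - 1) - p.1) (0, y) := by fun_prop
  have e1 := h1.eventually (gt_mem_nhds (show _ < x₂ by simpa using hx))
  have e2 := h2.eventually (lt_mem_nhds (show v < _ by simpa using hv))
  have e3 := h3.eventually (lt_mem_nhds (show 0 < _ by simpa using hd))
  obtain ⟨ε, hε, hball⟩ := Metric.eventually_nhds_iff.1 (e1.and (e2.and e3))
  obtain ⟨θ, hθ, hblock⟩ := T.exists_hasBlock_univ (θ₀ := max 0 (y - ε)) (le_max_left _ _)
    (max_lt hy (by linarith)) le_rfl hy1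
  have hθ0 : 0 < θ := (le_max_left _ _).trans_lt hθ.1
  have hθε : y - ε < θ := (le_max_right _ _).trans_lt hθ.1
  obtain ⟨p1, p2, p3⟩ := @hball (ε / 2, θ) (by
    rw [Prod.dist_eq, max_lt_iff, Real.dist_eq, Real.dist_eq, sub_zero, abs_of_pos (half_pos hε),
      abs_of_nonpos (by linarith [hθ.2])]
    constructor <;> linarith)
  refine (hblock (b ^ 2 / (2 * b - 1) + ε / 2) (1 / (2 * b - 1) - ε / 2) _ _ x₁ x₂
    (hasBlocks_of_lt hb ?_ p3.le ?_) p3.le ?_ p1.le).mono p2.le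
  · rw [mul_add, mul_div_cancel₀ _ hd.ne']
    linarith [mul_pos hd (half_pos hε)]
  · rw [mul_sub, mul_div_cancel₀ _ hd.ne']
    linarith [mul_pos hd (half_pos hε)]
  · have := (hden θ hθ0.le (hθ.2.trans hy1)).ne'
    refine Eq.trans (b := x₁ / (θ + (1 - θ) * b) * (θ + (1 - θ) * b)) ?_ (div_mul_cancel₀ _ this)
    ring

theorem hasBlock_univ_of_ne_zero [IsProbabilityMeasure μ₀] (T : MeasureTree μ₀)
    {x₁ x₂ y t v : ℝ} (hx₂ : 0 < x₂) (hy : 0 < y) (hy1 : y ≤ 1) (ht : 0 < t) (ht2 : t < 1 / 2)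
    (h : x₁ ^ 2 / x₂ = foliationRatio (1 - y) t) (hv : v < normalizedB x₂ y t) :
    T.HasBlock univ x₁ x₂ y v := by
  have hpos : ∀ s : ℝ, 0 < s → s ≤ t → 0 < 1 - s ∧ 0 < 1 - 2 * s ∧ 0 < 1 - 2 * s * (1 - y) ∧
      0 < y + (1 - y) * (1 - s) := fun s h0 h1 =>
    ⟨by linarith, by linarith, by nlinarith, by nlinarith⟩
  obtain ⟨q1, q2, q3, q4⟩ := hpos t ht le_rfl
  have hcont : ContinuousAt (fun s => (x₁ / (y + (1 - y) * (1 - s))) ^ 2 *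
      (1 / (2 * (1 - s) - 1)) * y) t := by
    have h1 : ContinuousAt (fun s => x₁ / (y + (1 - y) * (1 - s))) t :=
      ContinuousAt.div (by fun_prop) (by fun_prop) q4.ne'
    have h2 : ContinuousAt (fun s : ℝ => 1 / (2 * (1 - s) - 1)) t :=
      ContinuousAt.div (by fun_prop) (by fun_prop) (by linarith : 0 < 2 * (1 - t) - 1).ne'
    fun_prop
  have hval : (x₁ / (y + (1 - y) * (1 - t))) ^ 2 * (1 / (2 * (1 - t) - 1)) * y =
      normalizedB x₂ y t := by
    have e1 : y + (1 - y) * (1 - t) = 1 - t * (1 - y) := by ring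
    have e2 : 2 * (1 - t) - 1 = 1 - 2 * t := by ring
    rw [e1] at q4
    rw [div_eq_iff hx₂.ne', foliationRatio] at h
    rw [e1, e2, div_pow, h, normalizedB]
    generalize 1 - t * (1 - y) = e at *
    generalize 1 - 2 * t * (1 - y) = d at *
    generalize 1 - 2 * t = f at *
    field_simp
  -- At `b = 1 - t` the square average would be exactly `x₂`. Taking `s < t` and `b = 1 - s` loses
  -- arbitrarily little payoff and, by strict monotonicity of `foliationRatio`, makes that
  -- constraint strict.
  have hev := (hcont.eventually (lt_mem_nhds (hval ▸ hv))).filter_mono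
    (nhdsWithin_le_nhds (s := Iio t))
  obtain ⟨s, hsv, hs⟩ := (hev.and (Ioo_mem_nhdsLT ht)).exists
  obtain ⟨r1, r2, r3, r4⟩ := hpos s hs.1 hs.2.le
  refine T.hasBlock_univ_of_lt (b := 1 - s) (by linarith) hy hy1 ?_ hsv
  have hanti := foliationRatio_strictAntiOn (z := 1 - y) (by linarith) (by linarith)
    ⟨hs.1.le, by linarith⟩ ⟨ht.le, ht2.le⟩ hs.2
  rw [← h, div_lt_iff₀ hx₂, foliationRatio] at hanti
  have e1 : y + (1 - y) * (1 - s) = 1 - s * (1 - y) := by ring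
  have e2 : 2 * (1 - s) - 1 = 1 - 2 * s := by ring
  have e3 : y + (1 - 2 * s) * (1 - y) = 1 - 2 * s * (1 - y) := by ring
  rw [e1] at r4
  rw [e1, e2]
  have e4 : (x₁ / (1 - s * (1 - y))) ^ 2 * ((1 - s) ^ 2 / (1 - 2 * s)) * y +
      ((1 - s) * (x₁ / (1 - s * (1 - y)))) ^ 2 * (1 - y) =
      x₁ ^ 2 * ((1 - s) ^ 2 * (1 - 2 * s * (1 - y)) / ((1 - s * (1 - y)) ^ 2 * (1 - 2 * s))) := by
    rw [← e3]
    generalize 1 - s * (1 - y) = e at *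
    generalize 1 - 2 * s = f at *
    field_simp
  rw [e4]
  have hk : 0 < (1 - s) ^ 2 * (1 - 2 * s * (1 - y)) / ((1 - s * (1 - y)) ^ 2 * (1 - 2 * s)) := by
    positivity
  refine (mul_lt_mul_of_pos_right hanti hk).trans_eq ?_
  generalize 1 - s * (1 - y) = e at *
  generalize 1 - 2 * s * (1 - y) = d at *
  generalize 1 - 2 * s = f at *
  field_simp

/-- Here `b` must tend to `1/2`, where `W` and `V` blow up with `V / W → 4`. The scale `c` comes
from `x₂` instead of `x₁`, and the remainder compensates the mean; a part of any size `θ` serves, so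
the value `4 x₂` does not involve `y`. -/
theorem hasBlock_univ_of_eq_zero [IsProbabilityMeasure μ₀] (T : MeasureTree μ₀) {x₂ y v : ℝ}
    (hx₂ : 0 < x₂) (hy : 0 < y) (hy1 : y ≤ 1) (hv : v < 4 * x₂) : T.HasBlock univ 0 x₂ y v := by
  obtain ⟨θ, hθ, hblock⟩ := T.exists_hasBlock_univ (θ₀ := 0) (θ₁ := y / 2) le_rfl (by linarith)
    (by linarith) hy1
  have hθ0 : 0 < θ := hθ.1
  have hθ1 : 0 < 1 - θ := by linarith [hθ.2]
  have hcont : ContinuousAt (fun d : ℝ =>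
      x₂ * (1 - d) / (((1 + d) / 2) ^ 2 + d + d * (θ / (1 - θ)))) 0 :=
    ContinuousAt.div (by fun_prop) (by fun_prop) (by norm_num)
  have h0 : x₂ * (1 - 0) / (((1 + 0) / 2) ^ 2 + 0 + 0 * (θ / (1 - θ))) = 4 * x₂ := by
    norm_num
    ring
  have hev := (hcont.eventually (lt_mem_nhds (h0.symm ▸ hv))).filter_mono
    (nhdsWithin_le_nhds (s := Ioi 0))
  obtain ⟨d, hdv, hd⟩ := (hev.and (Ioo_mem_nhdsGT one_pos)).exists
  have hd0 : 0 < d := hd.1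
  have hd1 : 0 < 1 - d := by linarith [hd.2]
  -- With `b = (1 + d) / 2` one has `2b - 1 = d`; the `+ 1` here and the `- 1` in `1 / d - 1`
  -- provide the strict inequalities.
  set W := ((1 + d) / 2) ^ 2 / d + 1 with hW
  have hW0 : 0 < W := by positivity
  set c := √(x₂ / (θ * W + θ ^ 2 / (1 - θ))) with hc
  have hc2 : c ^ 2 * (θ * W + θ ^ 2 / (1 - θ)) = x₂ := by
    rw [hc, Real.sq_sqrt (by positivity), div_mul_cancel₀ _ (by positivity)]
  have hV0 : 0 ≤ 1 / d - 1 := by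
    rw [sub_nonneg, one_le_div hd0]
    linarith
  refine (hblock W (1 / d - 1) c (-θ * c / (1 - θ)) 0 x₂
    (hasBlocks_of_lt (b := (1 + d) / 2) (by linarith) ?_ hV0 ?_) hV0 ?_ ?_).mono
    (hdv.le.trans (le_of_eq ?_))
  · have : 2 * ((1 + d) / 2) - 1 = d := by ring
    rw [this, hW, mul_add, mul_div_cancel₀ _ hd0.ne']
    linarith
  · have : 2 * ((1 + d) / 2) - 1 = d := by ring
    rw [this, mul_sub, mul_one_div_cancel hd0.ne']
    linarith
  · field_simp
    ring
  · refine le_of_eq (Eq.trans ?_ hc2)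
    field_simp
  · rw [← hc2, hW]
    field_simp

theorem bellman_eq_of_sq_eq [IsProbabilityMeasure μ₀] (T : MeasureTree μ₀) {m M x₁ x₂ x₃ : ℝ}
    (hm : 0 ≤ m) (hx : x₁ ^ 2 = x₂) (hmx : m < x₃) (hxM : x₃ ≤ M) :
    T.bellman m M x₁ x₂ x₃ = ((x₃ * x₂ : ℝ) : EReal) := by
  have hMm : 0 < M - m := by linarith
  have hx₂ : 0 ≤ x₂ := hx ▸ sq_nonneg _
  have hR : 0 ≤ x₃ * x₂ := mul_nonneg (by linarith) hx₂
  refine le_antisymm (bellman_le hR fun φ μ α h => (h.payoff_eq_of_sq_eq hx).le) ?_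
  obtain ⟨φ, μ, α, h, -⟩ := (T.hasBlock_base T.univ_mem (c := x₁) (s := x₂)
    (y := (x₃ - m) / (M - m)) (by rw [probReal_univ, mul_one, hx])
    (div_nonneg (by linarith) hMm.le)
    (div_le_one_of_le₀ (by linarith) hMm.le)).exists_isCompetitor (x₃ := x₃) hm
    (by linarith : m ≤ M) (div_nonneg (by linarith) hMm.le)
    (by rw [mul_div_cancel₀ _ hMm.ne']; ring)
  refine le_trans (le_of_eq ?_) (le_sSup ⟨φ, μ, α, h, rfl⟩)
  rw [h.payoff_eq_of_sq_eq hx, EReal.coe_ennreal_ofReal, max_eq_left hR]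

theorem bellman_eq_of_foliationRatio_eq [IsProbabilityMeasure μ₀] (T : MeasureTree μ₀)
    {m M x₁ x₂ x₃ t : ℝ} (hm : 0 ≤ m) (hx₂ : 0 < x₂) (hmx : m < x₃) (hxM : x₃ ≤ M) (ht0 : 0 < t)
    (ht2 : t ≤ 1 / 2) (h : x₁ ^ 2 / x₂ = foliationRatio (1 - (x₃ - m) / (M - m)) t) :
    T.bellman m M x₁ x₂ x₃ =
      (((M - m) * normalizedB x₂ ((x₃ - m) / (M - m)) t + m * x₂ : ℝ) : EReal) := by
  have hMm : 0 < M - m := by linarith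
  set y := (x₃ - m) / (M - m) with hy
  have hy0 : 0 < y := div_pos (by linarith) hMm
  have hy1 : y ≤ 1 := div_le_one_of_le₀ (by linarith) hMm.le
  have hx₃ : x₃ = m + (M - m) * y := by rw [hy, mul_div_cancel₀ _ hMm.ne']; ring
  have hd : 0 < 1 - 2 * t * (1 - y) := by nlinarith
  have hB0 : 0 ≤ normalizedB x₂ y t := by
    rw [normalizedB]
    positivity
  refine le_antisymm (bellman_le (by positivity) fun φ μ α hc => ?_) ?_
  · refine (hc.payoff_le hm (by linarith) (by linarith) ht0 (by linarith)).trans (le_of_eq ?_)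
    rw [← normalizedB_eq hx₂ hy0 ht0 ht2 h]
    congr 2
    ring
  · have hblock : ∀ v < normalizedB x₂ y t, T.HasBlock univ x₁ x₂ y v := by
      intro v hv
      -- At `t = 1/2` the choice `b = 1 - t` is excluded by `1/2 < b`.
      rcases ht2.eq_or_lt with ht | ht
      · have hx₁ : x₁ = 0 := by
          rw [ht, foliationRatio, div_eq_iff hx₂.ne'] at h
          norm_num at h
          exact h
        have hB : normalizedB x₂ y t = 4 * x₂ := by
          have e : 1 - 2 * (1 / 2) * (1 - y) = y := by ring
          rw [ht, normalizedB, e]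
          field_simp
          ring
        rw [hx₁]
        exact T.hasBlock_univ_of_eq_zero hx₂ hy0 hy1 (hB ▸ hv)
      · exact T.hasBlock_univ_of_ne_zero hx₂ hy0 hy1 ht0 ht h hv
    refine EReal.ge_of_forall_gt_iff_ge.1 fun z hz => ?_
    have hz' : (z - m * x₂) / (M - m) < normalizedB x₂ y t := by
      rw [div_lt_iff₀ hMm]
      linarith [EReal.coe_lt_coe_iff.1 hz]
    have := (hblock _ hz').le_bellman (x₃ := x₃) hm (by linarith : m ≤ M) hy0.le hx₃
    rwa [mul_div_cancel₀ _ hMm.ne', sub_add_cancel] at this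

theorem bellman_eq_of_eq [IsProbabilityMeasure μ₀] (T : MeasureTree μ₀) {m M x₁ x₂ : ℝ}
    (hm : 0 ≤ m) (hx : x₁ ^ 2 ≤ x₂) (hmM : m ≤ M) :
    T.bellman m M x₁ x₂ m = ((m * x₂ : ℝ) : EReal) := by
  refine le_antisymm (bellman_le (mul_nonneg hm ((sq_nonneg _).trans hx))
    fun φ μ α h => h.payoff_le_of_eq hm) ?_
  have h := (T.hasBlock_base T.univ_mem (c := x₁) (s := x₂) (y := 0)
    (by rwa [probReal_univ, mul_one]) le_rfl zero_le_one).le_bellman (x₃ := m) hm hmM le_rfl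
    (by ring)
  rwa [mul_zero, zero_add] at h

end MeasureTree

theorem mainTheorem5 {X : Type*} [MeasurableSpace X] (μ₀ : Measure X) [IsProbabilityMeasure μ₀]
    (T : MeasureTree μ₀) (m M x₁ x₂ x₃ : ℝ) (hm : 0 ≤ m) (hx : x₁ ^ 2 ≤ x₂)
    (hmx : m ≤ x₃) (hxM : x₃ ≤ M) :
    (m < x₃ → 0 < x₂ → ∃ a : ℝ, IsCubicSolution m M x₁ x₂ x₃ a ∧
      (∀ b : ℝ, IsCubicSolution m M x₁ x₂ x₃ b → b = a) ∧
      T.bellman m M x₁ x₂ x₃ = ((explicitB m M x₂ x₃ a : ℝ) : EReal)) ∧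
    (m < x₃ → x₂ = 0 → T.bellman m M x₁ x₂ x₃ = 0) ∧
    (x₃ = m → T.bellman m M x₁ x₂ x₃ = ((m * x₂ : ℝ) : EReal)) := by
  refine ⟨fun hlt hx₂ => ?_, fun hlt hx₂ => ?_, fun he => ?_⟩
  · have hmM : m < M := hlt.trans_le hxM
    have hMm := sub_pos.2 hmM
    have hz : 0 ≤ (M - x₃) / (M - m) := div_nonneg (sub_nonneg.2 hxM) hMm.le
    have hz1 : (M - x₃) / (M - m) < 1 := by
      rw [div_lt_one hMm]
      linarith
    have hzy : 1 - (x₃ - m) / (M - m) = (M - x₃) / (M - m) := by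
      field_simp
      ring
    obtain ⟨t, ht, hft⟩ := exists_foliationRatio_eq hz hz1
      (⟨by positivity, (div_le_one hx₂).2 hx⟩ : x₁ ^ 2 / x₂ ∈ Icc (0 : ℝ) 1)
    have hta : 2 * (t / (2 * (M - m))) * (M - m) = t := by field_simp
    refine ⟨t / (2 * (M - m)), ?_, fun b hb => ?_, ?_⟩
    · rw [isCubicSolution_iff hmM, hta]
      exact ⟨ht, hft.symm⟩
    · obtain ⟨hb1, hb2⟩ := (isCubicSolution_iff hmM b).1 hb
      have := (foliationRatio_strictAntiOn hz hz1).injOn hb1 ht (hb2.symm.trans hft.symm)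
      rw [← this]
      field_simp
    · rw [explicitB_eq hmM, hta]
      -- At `t = 0` the supersolution sees no payoff; the equation then reads `x₁² = x₂` and `φ` is
      -- almost everywhere constant.
      rcases ht.1.eq_or_lt with h0 | h0
      · subst h0
        have hsq : x₁ ^ 2 = x₂ := by
          have : foliationRatio ((M - x₃) / (M - m)) 0 = 1 := by simp [foliationRatio]
          rw [this] at hft
          exact (eq_of_div_eq_one hft.symm)
        rw [T.bellman_eq_of_sq_eq hm hsq hlt hxM, normalizedB]
        have e : (M - m) * ((x₃ - m) / (M - m)) = x₃ - m := mul_div_cancel₀ _ hMm.ne'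
        congr 1
        simp only [mul_zero, zero_mul, sub_zero, one_pow, mul_one, div_one]
        rw [← mul_assoc, e]
        ring
      · exact T.bellman_eq_of_foliationRatio_eq hm hx₂ hlt hxM h0 ht.2 (by rw [hzy, hft])
  · have hx₁ : x₁ ^ 2 = x₂ := le_antisymm hx (hx₂ ▸ sq_nonneg _)
    rw [T.bellman_eq_of_sq_eq hm hx₁ hlt hxM, hx₂, mul_zero, EReal.coe_zero]
  · subst he
    exact T.bellman_eq_of_eq hm hx hxM
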